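/- A polyhedral surface in the spherical 3-space $\mathbb S^3$ (the unit sphere of $\mathbb R^4$) is given by a finite closed coherently oriented triangulated surface $K$ together with a position in $\mathbb S^3$ of every vertex of $K$, such that the vertices of every triangle of $K$ are placed at linearly independent vectors; every triangle is realized by the geodesic spherical triangle that its vertices span (adjacent triangles may be coplanar, so polygonal faces are allowed). It has no selfintersections if any two of its triangles meet only in the common vertex, edge or triangle that they have in $K$. It is nonconvex if it is not the boundary of a convex subset of $\mathbb S^3$. Dihedral angles $\alpha(\ell)$ are measured on one fixed side of the oriented surface. The total mean curvature is $\frac12\sum_\ell(\pi-\alpha(\ell))|\ell|$, summed over all edges $\ell$, where $|\ell|$ is the length of $\ell$. The Gauss curvature of a vertex is $2\pi$ minus the sum of all plane angles of the surface at this vertex. **Theorem 4.** In $\mathbb S^3$ there exist a polyhedral surface $P$ and a continuous family $(P_t)_{t\in[0,1]}$ of polyhedral surfaces with the same combinatorial structure $K$ (the vertices move continuously), $P_0=P$, such that (i) every $P_t$, in particular $P$, is nonconvex, homeomorphic to the 2-sphere and has no selfintersections; (ii) every dihedral angle of $P_t$ is independent of $t$, and the deformation is nontrivial: for some $t$ no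 isometry of $\mathbb S^3$ maps $P_0$ onto $P_t$; (iii) the surface area of $P_t$ is nonconstant in $t$; (iv) the total mean curvature of $P_t$ is nonconstant in $t$; (v) the Gauss curvature of some vertex of $P_t$ is nonconstant in $t$. -/

import Mathlib

noncomputable section

/-- The ambient Euclidean space `ℝ⁴`. -/
abbrev E4 : Type := EuclideanSpace ℝ (Fin 4)

/-- The spherical 3-space: the unit sphere of `ℝ⁴`. Its (chordal) isometries are exactly the
isometries of the intrinsic metric. -/
abbrev S3 : Type := Metric.sphere (0 : E4) 1

/-- The 2-sphere, as a topological space. -/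
abbrev S2 : Type := Metric.sphere (0 : EuclideanSpace ℝ (Fin 3)) 1

/-- A finite closed coherently oriented triangulated surface with vertex set `Fin n`.
An oriented triangle is recorded by its three cyclically equivalent ordered triples. -/
structure OrientedTriangulation (n : ℕ) where
  /-- the ordered triples `(u, v, w)` such that `uvw` is a positively oriented triangle -/
  faces : Finset (Fin n × Fin n × Fin n)
  rotate : ∀ u v w, (u, v, w) ∈ faces → (v, w, u) ∈ faces
  ne : ∀ u v w, (u, v, w) ∈ faces → u ≠ v
  /-- a directed edge lies in at most one positively oriented triangle -/
  unique : ∀ u v w w', (u, v, w) ∈ faces → (u, v, w') ∈ faces → w = w'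
  /-- there is no boundary: on the other side of every edge there is another triangle,
  coherently oriented -/
  closed : ∀ u v w, (u, v, w) ∈ faces → ∃ w', w' ≠ w ∧ (v, u, w') ∈ faces
  /-- every vertex belongs to a triangle -/
  used : ∀ u, ∃ v w, (u, v, w) ∈ faces

/-- The vertex set of the triangle given by an ordered triple. -/
def vertexSet {n : ℕ} (f : Fin n × Fin n × Fin n) : Finset (Fin n) := {f.1, f.2.1, f.2.2}

/-- The spherical simplex spanned by the points `p i`, `i ∈ s`: the points of the sphere that are
linear combinations of these points with nonnegative coefficients. -/
def cell {n : ℕ} (p : Fin n → S3) (s : Finset (Fin n)) : Set S3 :=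
  {x | ∃ c : Fin n → ℝ, (∀ i, 0 ≤ c i) ∧ (x : E4) = ∑ i ∈ s, c i • (p i : E4)}

/-- The component of `x` orthogonal to the vectors of `A`. -/
def perp (A : Set E4) (x : E4) : E4 := (Submodule.span ℝ A)ᗮ.starProjection x

/-- The length of the geodesic segment `uv`. -/
def edgeLength (u v : S3) : ℝ := InnerProductGeometry.angle (u : E4) (v : E4)

/-- The plane angle at the vertex `u` of the spherical triangle `uvw`: the angle between the
directions at `u` of the sides `uv` and `uw`. -/
def planeAngle (u v w : S3) : ℝ :=
  InnerProductGeometry.angle (perp {(u : E4)} v) (perp {(u : E4)} w)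

/-- The determinant of four vectors of `ℝ⁴`. -/
def det4 (u v w w' : E4) : ℝ := (Matrix.of fun i j : Fin 4 => (![u, v, w, w'] i) j).det

/-- The dihedral angle, in `[0, 2π)`, at the edge `uv` between the positively oriented triangles
`uvw` and `vuw'`. It is the angle through which the half-plane of `uvw` has to be turned about the
edge, in the positive sense of the oriented normal plane of the edge, to reach the half-plane of
`vuw'`; i.e. the dihedral angle measured on the side of the surface into which the normals `ν`
with `det (u, v, w, ν) > 0` of the positively oriented triangles point. -/
def dihedralAngle (u v w w' : S3) : ℝ :=
  if 0 ≤ det4 u v w w' then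
    InnerProductGeometry.angle (perp {(u : E4), (v : E4)} w) (perp {(u : E4), (v : E4)} w')
  else
    2 * Real.pi -
      InnerProductGeometry.angle (perp {(u : E4), (v : E4)} w) (perp {(u : E4), (v : E4)} w')

/-- A subset of the sphere is convex if with any two points that are not antipodal it contains the
shortest geodesic segment joining them. -/
def SphericallyConvex (D : Set S3) : Prop :=
  ∀ x ∈ D, ∀ y ∈ D, ∀ z : S3,
    (∃ a b : ℝ, 0 ≤ a ∧ 0 ≤ b ∧ (z : E4) = a • (x : E4) + b • (y : E4)) → z ∈ D

/-- A surface in the sphere is convex if it is the boundary of a convex set. -/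
def IsConvexSurface (S : Set S3) : Prop := ∃ D : Set S3, SphericallyConvex D ∧ frontier D = S

open scoped MeasureTheory in
/-- The area of a surface in the sphere: the 2-dimensional Hausdorff measure, normalized so that it
extends the area in the Euclidean plane. -/
def surfaceArea (S : Set S3) : ENNReal := ENNReal.ofReal (Real.pi / 4) * μH[2] S

/-- Two subsets of the sphere are congruent if an isometry of the sphere maps one to the other. -/
def Congruent3 (S S' : Set S3) : Prop := ∃ g : S3 ≃ᵢ S3, g '' S = S'

namespace OrientedTriangulation

variable {n : ℕ} (K : OrientedTriangulation n)

/-- The polyhedral surface with combinatorial structure `K` and vertices `p i`: the union of its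
triangles. -/
def surface (p : Fin n → S3) : Set S3 := ⋃ f ∈ K.faces, cell p (vertexSet f)

/-- All triangles are nondegenerate. -/
def Nondegenerate (p : Fin n → S3) : Prop :=
  ∀ u v w, (u, v, w) ∈ K.faces → LinearIndependent ℝ ![(p u : E4), (p v : E4), (p w : E4)]

/-- There are no selfintersections: two triangles have no common points except those of the
common vertex, edge or triangle that they have in `K`. -/
def Embedded (p : Fin n → S3) : Prop :=
  ∀ f ∈ K.faces, ∀ g ∈ K.faces,
    cell p (vertexSet f) ∩ cell p (vertexSet g) ⊆ cell p (vertexSet f ∩ vertexSet g)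

/-- The polyhedral surface is homeomorphic to the 2-sphere. -/
def SphereHomeomorphic (p : Fin n → S3) : Prop := Nonempty (K.surface p ≃ₜ S2)

/-- The edges of `K`, each listed once as `(u, v, w, w')`, where `u < v` are the ends of the edge
and `uvw`, `vuw'` are the two positively oriented triangles that contain it. -/
def hinges : Finset (Fin n × Fin n × Fin n × Fin n) :=
  Finset.univ.filter fun h =>
    h.1 < h.2.1 ∧ (h.1, h.2.1, h.2.2.1) ∈ K.faces ∧ (h.2.1, h.1, h.2.2.2) ∈ K.faces

/-- The dihedral angle at an edge. -/
def dihedralAt (p : Fin n → S3) (h : Fin n × Fin n × Fin n × Fin n) : ℝ :=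
  dihedralAngle (p h.1) (p h.2.1) (p h.2.2.1) (p h.2.2.2)

/-- The total mean curvature: half the sum of `(π - α) ℓ` over all edges, with `α` the dihedral
angle at the edge and `ℓ` its length. -/
def totalMeanCurvature (p : Fin n → S3) : ℝ :=
  (1 / 2) * ∑ h ∈ K.hinges, (Real.pi - dihedralAt p h) * edgeLength (p h.1) (p h.2.1)

/-- The Gauss curvature of a vertex: `2π` minus the sum of the plane angles at this vertex (every
triangle that contains `v` occurs exactly once among the ordered triples starting with `v`). -/
def gaussCurvature (p : Fin n → S3) (v : Fin n) : ℝ :=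
  2 * Real.pi - ∑ f ∈ K.faces.filter (fun f => f.1 = v), planeAngle (p f.1) (p f.2.1) (p f.2.2)

end OrientedTriangulation

end

/-! Place the apex at the pole of a great sphere and the base, a spherical quadrilateral, in that
great sphere. Then every dihedral angle at a base side is a right angle, every dihedral angle at a
lateral edge equals the angle of the base at its end, and the diagonal of the base is flat. So
deforming the pyramid with fixed dihedral angles amounts to deforming a spherical quadrilateral with
fixed angles. Unlike a Euclidean or hyperbolic cone over it, the pyramid turns the side lengths of
the base directly into plane angles at the apex: the lateral edges all have length π/2 and the apex
angles are the base sides.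

The base is a lune with two right angles minus a Lambert quadrilateral, the one with corners `0`,
`1`, `2` and the antipode of `3`. It has angles π/2, 3π/2, arccos(xy), π/2 at `0`, `1`, `2`, `3`, so
it is nonconvex, and keeping the product xy fixed keeps all four angles
(`Admissible.dihedralAt_eq`). Gauss curvature at the apex, total mean curvature and lateral area
then depend on the perimeter of the base only, up to constants. The value 12/25 = (3/5)(4/5) makes
the endpoints of the deformation rational up to ρ and interchanges x and y between them, so that
unequal perimeters reduce to 7/25 ≠ 5/13 (`arccos_sub_arccos_ne`). The two bases have equal area,
because the lunes and the removed Lambert quadrilaterals are congruent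
(`hausdorffMeasure_baseQuad_swap`).

Embeddedness, nonconvexity and the topological type all follow from the single linear relation among
the vertices, XY p₀ + ρ p₂ + X p₃ = Y p₁ (`Admissible.exists_of_sum_eq`), which puts the reflex
vertex `1` inside the triangle `023`. -/

noncomputable section

/-! ### The pyramid, its linear relation and embeddedness -/

/-- The combinatorial structure of the pyramid with apex `4` over the quadrilateral `0123`, which
is cut along its diagonal `13`. -/
def pyramid : OrientedTriangulation 5 where
  faces := {(4,0,1), (0,1,4), (1,4,0), (4,1,2), (1,2,4), (2,4,1), (4,2,3), (2,3,4), (3,4,2),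
    (4,3,0), (3,0,4), (0,4,3), (0,3,1), (3,1,0), (1,0,3), (1,3,2), (3,2,1), (2,1,3)}
  rotate := by decide +kernel
  ne := by decide +kernel
  unique := by decide +kernel
  closed := by decide +kernel
  used := by decide +kernel

/-- The sines `x`, `y` and cosines `X`, `Y` of two acute angles with a fixed product of sines, and
the number `ρ` that completes this product to a point of the unit circle. -/
structure Admissible (x X y Y ρ : ℝ) : Prop where
  x_pos : 0 < x
  X_pos : 0 < X
  y_pos : 0 < y
  Y_pos : 0 < Y
  ρ_pos : 0 < ρ
  x_sq : x ^ 2 + X ^ 2 = 1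
  y_sq : y ^ 2 + Y ^ 2 = 1
  prod : x * y = 12 / 25
  ρ_sq : ρ ^ 2 = 1 - (x * y) ^ 2

/-- A vector as a point of the sphere, if it is a unit vector. -/
def toSphere (v : E4) : S3 :=
  if h : ‖v‖ = 1 then ⟨v, by simpa using h⟩ else ⟨EuclideanSpace.single 0 1, by simp⟩

/-- The vertices of the pyramid as vectors. -/
def vertexVec (x X y Y ρ : ℝ) : Fin 5 → E4 :=
  ![!₂[1, 0, 0, 0], !₂[X, x, 0, 0], !₂[X * Y / ρ, x * Y / ρ, X * y / ρ, 0], !₂[-Y, 0, -y, 0],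
    !₂[0, 0, 0, 1]]

/-- The vertices of the pyramid. -/
def vertexPos (x X y Y ρ : ℝ) (i : Fin 5) : S3 := toSphere (vertexVec x X y Y ρ i)

lemma norm_eq_one_of_sq {v : E4} (h : v 0 ^ 2 + v 1 ^ 2 + v 2 ^ 2 + v 3 ^ 2 = 1) : ‖v‖ = 1 := by
  rw [EuclideanSpace.norm_eq, Fin.sum_univ_four]
  simp [h]

namespace Admissible

variable {x X y Y ρ : ℝ} (h : Admissible x X y Y ρ)
include h

lemma norm_vertexVec (i : Fin 5) : ‖vertexVec x X y Y ρ i‖ = 1 := by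
  have := h.x_sq
  have := h.y_sq
  have := h.ρ_sq
  have := h.ρ_pos
  apply norm_eq_one_of_sq
  fin_cases i <;> simp [vertexVec]
  · linarith
  · field_simp
    rw [h.ρ_sq]
    nlinarith
  · linarith

lemma coe_vertexPos (i : Fin 5) : (vertexPos x X y Y ρ i : E4) = vertexVec x X y Y ρ i := by
  simp [vertexPos, toSphere, h.norm_vertexVec]

lemma sum_vertexPos (c : Fin 5 → ℝ) : ∑ i, c i • (vertexPos x X y Y ρ i : E4) =
    !₂[c 0 + c 1 * X + c 2 * (X * Y / ρ) - c 3 * Y, c 1 * x + c 2 * (x * Y / ρ),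
      c 2 * (X * y / ρ) - c 3 * y, c 4] := by
  simp only [h.coe_vertexPos, Fin.sum_univ_five]
  ext i
  fin_cases i <;> simp [vertexVec] <;> ring

/-- Five vectors spanning ℝ⁴ have a one-dimensional space of relations, here generated by XY p₀ − Y
p₁ + ρ p₂ + X p₃ = 0. What matters later is its sign pattern: positive at `0`, `2`, `3`, negative at
`1`. -/
lemma exists_of_sum_eq {c c' : Fin 5 → ℝ}
    (hc : ∑ i, c i • (vertexPos x X y Y ρ i : E4) = ∑ i, c' i • (vertexPos x X y Y ρ i : E4)) :
    ∃ κ : ℝ, c 0 = c' 0 + κ * (X * Y) ∧ c 1 = c' 1 - κ * Y ∧ c 2 = c' 2 + κ * ρ ∧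
      c 3 = c' 3 + κ * X ∧ c 4 = c' 4 := by
  rw [h.sum_vertexPos, h.sum_vertexPos] at hc
  have h0 := congr($hc 0)
  have h1 := congr($hc 1)
  have h2 := congr($hc 2)
  have h3 := congr($hc 3)
  simp at h0 h1 h2 h3
  have hx := h.x_pos
  have hy := h.y_pos
  have hρ := h.ρ_pos
  have e1 : c 1 - c' 1 = - ((c 2 - c' 2) / ρ * Y) := by
    have : x * (c 1 - c' 1 + (c 2 - c' 2) / ρ * Y) = 0 := by linear_combination h1
    rcases mul_eq_zero.1 this with h' | h' <;> linarith
  have e3 : c 3 - c' 3 = (c 2 - c' 2) / ρ * X := by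
    have : y * (c 3 - c' 3 - (c 2 - c' 2) / ρ * X) = 0 := by linear_combination -h2
    rcases mul_eq_zero.1 this with h' | h' <;> linarith
  refine ⟨(c 2 - c' 2) / ρ, ?_, by linarith, by field_simp; ring, by linarith, h3⟩
  linear_combination h0 - X * e1 + Y * e3

/-- The nonnegative coefficients of a vector are unique if not both of the vertices `0` and `2`
are used. -/
lemma coeff_unique {c c' : Fin 5 → ℝ} (hc0 : ∀ i, 0 ≤ c i) (hc0' : ∀ i, 0 ≤ c' i)
    (hs : c 0 = 0 ∨ c 2 = 0) (hs' : c' 0 = 0 ∨ c' 2 = 0)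
    (hc : ∑ i, c i • (vertexPos x X y Y ρ i : E4) = ∑ i, c' i • (vertexPos x X y Y ρ i : E4)) :
    c = c' := by
  obtain ⟨κ, e0, e1, e2, e3, e4⟩ := h.exists_of_sum_eq hc
  have hXY := mul_pos h.X_pos h.Y_pos
  have hρ := h.ρ_pos
  -- The relation has the same sign at `0` and `2`. A nonzero κ would therefore make a coefficient
  -- negative on one side at the index where the other side vanishes.
  have hκ : κ = 0 := by
    rcases lt_trichotomy κ 0 with hκ | hκ | hκ
    · have := mul_neg_of_neg_of_pos hκ hXY
      have := mul_neg_of_neg_of_pos hκ hρ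
      rcases hs' with hs' | hs' <;> linarith [hc0 0, hc0 2]
    · exact hκ
    · have := mul_pos hκ hXY
      have := mul_pos hκ hρ
      rcases hs with hs | hs <;> linarith [hc0' 0, hc0' 2]
  subst hκ
  ext i
  fin_cases i <;> simp_all

end Admissible

lemma mem_cell_iff {n : ℕ} {p : Fin n → S3} {s : Finset (Fin n)} {z : S3} :
    z ∈ cell p s ↔ ∃ c : Fin n → ℝ, (∀ i, 0 ≤ c i) ∧ (∀ i ∉ s, c i = 0) ∧
      (z : E4) = ∑ i, c i • (p i : E4) := by
  constructor
  · rintro ⟨c, hc, hz⟩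
    refine ⟨fun i => if i ∈ s then c i else 0, fun i => ?_, fun i hi => if_neg hi, ?_⟩
    · dsimp only
      split_ifs <;> simp [hc]
    · simp [hz, ite_smul]
  · rintro ⟨c, hc, hs, hz⟩
    refine ⟨c, hc, ?_⟩
    rw [hz]
    symm
    apply Finset.sum_subset (Finset.subset_univ _)
    intro i _ hi
    simp [hs i hi]

lemma pyramid_faces_avoid : ∀ f ∈ pyramid.faces, (0 : Fin 5) ∉ vertexSet f ∨ 2 ∉ vertexSet f := by
  decide +kernel

lemma pyramid_ne : ∀ f ∈ pyramid.faces, f.1 ≠ f.2.1 ∧ f.1 ≠ f.2.2 ∧ f.2.1 ≠ f.2.2 := by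
  decide +kernel

namespace Admissible

variable {x X y Y ρ : ℝ} (h : Admissible x X y Y ρ)
include h

/-- A common point has the same coefficients in both cells, hence they vanish outside both vertex
sets. -/
lemma cell_inter_subset {s s' : Finset (Fin 5)} (hs : 0 ∉ s ∨ 2 ∉ s) (hs' : 0 ∉ s' ∨ 2 ∉ s') :
    cell (vertexPos x X y Y ρ) s ∩ cell (vertexPos x X y Y ρ) s' ⊆
      cell (vertexPos x X y Y ρ) (s ∩ s') := by
  rintro z ⟨hz, hz'⟩
  obtain ⟨c, hc, hcs, e⟩ := mem_cell_iff.1 hz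
  obtain ⟨c', hc', hcs', e'⟩ := mem_cell_iff.1 hz'
  obtain rfl := h.coeff_unique hc hc' (hs.imp (hcs _) (hcs _)) (hs'.imp (hcs' _) (hcs' _))
    (e.symm.trans e')
  refine mem_cell_iff.2 ⟨c, hc, fun i hi => ?_, e⟩
  by_cases hi' : i ∈ s
  · exact hcs' i fun h' => hi (Finset.mem_inter.2 ⟨hi', h'⟩)
  · exact hcs i hi'

lemma embedded : pyramid.Embedded (vertexPos x X y Y ρ) := fun f hf g hg =>
  h.cell_inter_subset (pyramid_faces_avoid f hf) (pyramid_faces_avoid g hg)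

lemma eq_zero_of_sum_eq_zero {c : Fin 5 → ℝ} (hs : c 0 = 0 ∨ c 2 = 0)
    (hc : ∑ i, c i • (vertexPos x X y Y ρ i : E4) = 0) (i : Fin 5) : c i = 0 := by
  obtain ⟨κ, e0, e1, e2, e3, e4⟩ := h.exists_of_sum_eq (c' := 0) (by simpa using hc)
  have hXY := (mul_pos h.X_pos h.Y_pos).ne'
  have hρ := h.ρ_pos.ne'
  have hκ : κ = 0 := by
    rcases hs with hs | hs
    · simpa [hs, h.X_pos.ne', h.Y_pos.ne'] using e0
    · simpa [hs, hρ] using e2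
  subst hκ
  fin_cases i <;> simp_all

lemma nondegenerate : pyramid.Nondegenerate (vertexPos x X y Y ρ) := by
  intro u v w hf
  obtain ⟨huv, huw, hvw⟩ := pyramid_ne _ hf
  have hav := pyramid_faces_avoid _ hf
  rw [Fintype.linearIndependent_iff]
  intro g hg
  have key := h.eq_zero_of_sum_eq_zero
    (c := Pi.single u (g 0) + Pi.single v (g 1) + Pi.single w (g 2)) ?_ ?_
  · have k0 := key u
    have k1 := key v
    have k2 := key w
    simp only at huv huw hvw
    simp [huv, huw, hvw, huv.symm, huw.symm, hvw.symm] at k0 k1 k2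
    intro i
    fin_cases i <;> assumption
  · simp only [vertexSet, Finset.mem_insert, Finset.mem_singleton, not_or] at hav
    refine hav.imp ?_ ?_ <;>
    · rintro ⟨h1, h2, h3⟩
      simp [h1, h2, h3]
  · simpa [add_smul, Finset.sum_add_distrib, Pi.single_apply, ite_smul, Fin.sum_univ_three]
      using hg

end Admissible

end

/-! ### Nonconvexity and compactness -/

noncomputable section

open Set

/-- If the closure has an interior point, the affine span is the whole space, and a convex set with
full affine span already has interior points. So no assumption of nonempty interior is needed. -/
lemma Convex.interior_closure_of_finiteDimensional {E : Type*} [NormedAddCommGroup E]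
    [NormedSpace ℝ E] [FiniteDimensional ℝ E] {s : Set E} (hs : Convex ℝ s) :
    interior (closure s) = interior s := by
  refine subset_antisymm (fun x hx => ?_) (interior_mono subset_closure)
  have hne : (interior s).Nonempty := by
    rw [hs.interior_nonempty_iff_affineSpan_eq_top]
    have h1 : closure s ⊆ affineSpan ℝ s :=
      closure_minimal (subset_affineSpan ℝ s) (AffineSubspace.closed_of_finiteDimensional _)
    have h2 := isOpen_interior.affineSpan_eq_top ⟨x, hx⟩
    exact top_le_iff.1 (h2 ▸ affineSpan_le.2 (interior_subset.trans h1))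
  rwa [← hs.interior_closure_eq_interior_of_nonempty_interior hne]

/-- The cone over a convex subset of the sphere. -/
def SphericallyConvex.cone {D : Set S3} (hD : SphericallyConvex D) : ConvexCone ℝ E4 where
  carrier := {v | ∃ r : ℝ, 0 ≤ r ∧ ∃ z ∈ D, v = r • (z : E4)}
  smul_mem' := by
    rintro c hc _ ⟨r, hr, z, hz, rfl⟩
    exact ⟨c * r, by positivity, z, hz, by rw [mul_smul]⟩
  add_mem' := by
    rintro _ ⟨r, hr, z, hz, rfl⟩ _ ⟨r', hr', z', hz', rfl⟩
    by_cases h0 : r • (z : E4) + r' • (z' : E4) = 0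
    · exact ⟨0, le_rfl, z, hz, by rw [h0, zero_smul]⟩
    · set u := r • (z : E4) + r' • (z' : E4) with hu
      have hn : 0 < ‖u‖ := norm_pos_iff.2 h0
      refine ⟨‖u‖, hn.le, ⟨‖u‖⁻¹ • u, by simp [norm_smul, hn.ne']⟩, ?_, ?_⟩
      · refine hD z hz z' hz' _ ⟨‖u‖⁻¹ * r, ‖u‖⁻¹ * r', by positivity, by positivity, ?_⟩
        simp only [mul_smul, ← smul_add, ← hu]
      · simp [smul_smul, hn.ne']

lemma SphericallyConvex.coe_mem_cone_iff {D : Set S3} (hD : SphericallyConvex D) {z : S3} :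
    (z : E4) ∈ hD.cone ↔ z ∈ D := by
  constructor
  · rintro ⟨r, hr, z', hz', e⟩
    have h1 : ‖(z : E4)‖ = 1 := by simp
    have h2 : ‖(z' : E4)‖ = 1 := by simp
    rw [e, norm_smul, h2, mul_one, Real.norm_of_nonneg hr] at h1
    rw [h1, one_smul] at e
    rwa [Subtype.ext e]
  · exact fun hz => ⟨1, zero_le_one, z, hz, by simp⟩

/-- A convex surface does not meet the interior of the convex hull of the cone over it. -/
lemma IsConvexSurface.notMem_interior {S : Set S3} (hS : IsConvexSurface S) {z : S3} (hz : z ∈ S)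
    {U : Set E4} (hU : IsOpen U)
    (hUS : ∀ C : ConvexCone ℝ E4, (∀ z ∈ S, (z : E4) ∈ C) → U ⊆ C) : (z : E4) ∉ U := by
  obtain ⟨D, hD, rfl⟩ := hS
  intro hzU
  have hsub : U ⊆ closure (hD.cone : Set E4) := by
    refine hUS hD.cone.closure fun w hw => ?_
    have := image_closure_subset_closure_image (f := ((↑) : S3 → E4)) (s := D)
      continuous_subtype_val ⟨w, frontier_subset_closure hw, rfl⟩
    refine closure_mono ?_ this
    rintro _ ⟨w, hw, rfl⟩
    exact hD.coe_mem_cone_iff.2 hw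
  -- Convexity of the cone removes the closure, so `z` would be interior to `D` and not a frontier
  -- point.
  have hsub' : U ⊆ interior (hD.cone : Set E4) := by
    rw [← hD.cone.convex.interior_closure_of_finiteDimensional]
    exact interior_maximal hsub hU
  refine hz.2 (mem_interior.2 ⟨((↑) : S3 → E4) ⁻¹' U, fun w hw => ?_,
    hU.preimage continuous_subtype_val, hzU⟩)
  exact hD.coe_mem_cone_iff.1 (interior_subset (hsub' hw))

/-- When all vertices lie in an open hemisphere about `w`, pairing a unit vector of the cell with
`w` bounds each coefficient. The cell is then cut out of the sphere by the continuous image of a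
compact box. -/
lemma isCompact_cell {n : ℕ} {p : Fin n → S3} {w : E4} (hw : ∀ i, 0 < inner ℝ w (p i : E4))
    (s : Finset (Fin n)) : IsCompact (cell p s) := by
  let M : Fin n → ℝ := fun i => ‖w‖ / inner ℝ w (p i : E4)
  have hcont : Continuous fun c : Fin n → ℝ => ∑ i, c i • (p i : E4) := by fun_prop
  have hK : IsCompact (Icc 0 M ∩ {c | ∀ i ∉ s, c i = 0}) := by
    refine isCompact_Icc.inter_right ?_
    simp only [ofPred_forall]
    exact isClosed_iInter fun i => isClosed_iInter fun _ =>
      isClosed_eq (continuous_apply i) continuous_const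
  have key : cell p s = (↑) ⁻¹'
      ((fun c : Fin n → ℝ => ∑ i, c i • (p i : E4)) '' (Icc 0 M ∩ {c | ∀ i ∉ s, c i = 0})) := by
    ext z
    rw [mem_cell_iff]
    constructor
    · rintro ⟨c, hc, hs, e⟩
      refine ⟨c, ⟨⟨hc, fun i => ?_⟩, hs⟩, e.symm⟩
      rw [le_div_iff₀ (hw i)]
      calc c i * inner ℝ w (p i : E4) ≤ ∑ j, c j * inner ℝ w (p j : E4) :=
            Finset.single_le_sum (f := fun j => c j * inner ℝ w (p j : E4))
              (fun j _ => mul_nonneg (hc j) (hw j).le) (Finset.mem_univ i)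
        _ = inner ℝ w (z : E4) := by simp [e, inner_sum, inner_smul_right]
        _ ≤ ‖w‖ * ‖(z : E4)‖ := real_inner_le_norm _ _
        _ = ‖w‖ := by simp
    · rintro ⟨c, ⟨hc, hs⟩, e⟩
      exact ⟨c, hc.1, hs, e.symm⟩
  rw [key]
  exact ((hK.image hcont).isClosed.preimage continuous_subtype_val).isCompact

lemma pyramid_faces_avoid' : ∀ f ∈ pyramid.faces,
    (1 : Fin 5) ∉ vertexSet f ∨ 3 ∉ vertexSet f ∨ 4 ∉ vertexSet f := by
  decide +kernel

lemma exists_pyramid_face : ∀ i j : Fin 5, i = 0 ∨ i = 2 → j = 1 ∨ j = 3 ∨ j = 4 →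
    ∃ f ∈ pyramid.faces, ∀ k ∉ vertexSet f, k = i ∨ k = j := by
  decide +kernel

/-- Cutting the base makes the surface a bipyramid: its triangles are obtained by omitting one
vertex of the pair `0`, `2` and one of the triple `1`, `3`, `4`. -/
lemma mem_pyramid_surface_iff {p : Fin 5 → S3} {z : S3} : z ∈ pyramid.surface p ↔
    ∃ c : Fin 5 → ℝ, (∀ i, 0 ≤ c i) ∧ (c 0 = 0 ∨ c 2 = 0) ∧ (c 1 = 0 ∨ c 3 = 0 ∨ c 4 = 0) ∧
      (z : E4) = ∑ i, c i • (p i : E4) := by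
  simp only [OrientedTriangulation.surface, mem_iUnion, mem_cell_iff]
  constructor
  · rintro ⟨f, hf, c, hc, hs, e⟩
    exact ⟨c, hc, (pyramid_faces_avoid f hf).imp (hs _) (hs _),
      (pyramid_faces_avoid' f hf).imp (hs _) (Or.imp (hs _) (hs _)), e⟩
  · rintro ⟨c, hc, h1, h2, e⟩
    have h1' : ∃ i, (i = 0 ∨ i = 2) ∧ c i = 0 := by
      rcases h1 with h | h
      exacts [⟨0, by simp, h⟩, ⟨2, by simp, h⟩]
    have h2' : ∃ j, (j = 1 ∨ j = 3 ∨ j = 4) ∧ c j = 0 := by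
      rcases h2 with h | h | h
      exacts [⟨1, by simp, h⟩, ⟨3, by simp, h⟩, ⟨4, by simp, h⟩]
    obtain ⟨i, hi, hci⟩ := h1'
    obtain ⟨j, hj, hcj⟩ := h2'
    obtain ⟨f, hf, hk⟩ := exists_pyramid_face i j hi hj
    refine ⟨f, hf, c, hc, fun k hk' => ?_, e⟩
    rcases hk k hk' with rfl | rfl <;> assumption

namespace Admissible

variable {x X y Y ρ : ℝ} (h : Admissible x X y Y ρ)
include h

/-- The reflex edge `14` violates convexity: Y p₁ + p₄ = XY p₀ + ρ p₂ + X p₃ + p₄ is a strictly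
positive combination of the basis `0`, `2`, `3`, `4`, hence interior to every convex cone containing
the surface. -/
lemma not_isConvexSurface : ¬ IsConvexSurface (pyramid.surface (vertexPos x X y Y ρ)) := by
  intro hS
  have hx := h.x_pos
  have hX := h.X_pos
  have hy := h.y_pos
  have hY := h.Y_pos
  have hρ := h.ρ_pos
  let v : E4 := Y • (vertexPos x X y Y ρ 1 : E4) + (vertexPos x X y Y ρ 4 : E4)
  have hv : v = !₂[X * Y, x * Y, 0, 1] := by
    ext i
    fin_cases i <;> simp [v, h.coe_vertexPos, vertexVec] <;> ring
  have hvn : 0 < ‖v‖ := norm_pos_iff.2 fun h0 => by simpa [hv] using congr($h0 3)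
  let z : S3 := ⟨‖v‖⁻¹ • v, by simp [norm_smul, hvn.ne']⟩
  -- Up to positive factors, the four inequalities say that the coefficients at `4`, `2`, `3`, `0`
  -- in that basis are positive.
  let U : Set E4 := {w | 0 < w 3} ∩ ({w | 0 < w 1} ∩ ({w | 0 < X * w 1 / (x * Y) - w 2 / y} ∩
    {w | 0 < w 0 - Y * w 2 / y}))
  refine hS.notMem_interior (z := z) (U := U) ?_ ?_ ?_ ?_
  · refine mem_pyramid_surface_iff.2 ⟨![0, ‖v‖⁻¹ * Y, 0, 0, ‖v‖⁻¹], ?_, ?_⟩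
    · intro i
      fin_cases i <;> simp <;> positivity
    · simp [z, v, Fin.sum_univ_five, smul_smul]
  · have e (i : Fin 4) : Continuous fun w : E4 => w i := by fun_prop
    refine (isOpen_lt continuous_const (e 3)).inter ((isOpen_lt continuous_const (e 1)).inter
      ((isOpen_lt continuous_const ?_).inter (isOpen_lt continuous_const ?_))) <;> fun_prop
  · rintro C hC w ⟨h3, h1, h2, h0⟩
    have hmem (i : Fin 5) : (vertexPos x X y Y ρ i : E4) ∈ C := by
      refine hC _ (mem_pyramid_surface_iff.2 ⟨Pi.single i 1, fun j => ?_, ?_, ?_, ?_⟩)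
      · rw [Pi.single_apply]; split_ifs <;> simp
      · fin_cases i <;> simp
      · fin_cases i <;> simp
      · simp [Pi.single_apply, ite_smul]
    have h1 : 0 < w 1 := h1
    have hw : w = (w 0 - Y * w 2 / y) • (vertexPos x X y Y ρ 0 : E4) +
        (ρ * w 1 / (x * Y)) • (vertexPos x X y Y ρ 2 : E4) +
        (X * w 1 / (x * Y) - w 2 / y) • (vertexPos x X y Y ρ 3 : E4) +
        w 3 • (vertexPos x X y Y ρ 4 : E4) := by
      ext i
      fin_cases i <;> simp [h.coe_vertexPos, vertexVec] <;> field_simp <;> ring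
    rw [hw]
    exact C.add_mem (C.add_mem (C.add_mem (C.smul_mem h0 (hmem _))
      (C.smul_mem (by positivity) (hmem _))) (C.smul_mem h2 (hmem _))) (C.smul_mem h3 (hmem _))
  · have : 0 < ‖v‖⁻¹ := inv_pos.2 hvn
    set r := ‖v‖⁻¹
    have hz : (z : E4) = !₂[r * (X * Y), r * (x * Y), 0, r] := by
      ext i
      fin_cases i <;> simp [z, r, hv]
    rw [hz]
    have hX' : X * (r * (x * Y)) / (x * Y) = X * r := by field_simp
    refine ⟨?_, ?_, ?_, ?_⟩ <;> simp [hX'] <;> positivity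

lemma isCompact_cell (s : Finset (Fin 5)) : IsCompact (cell (vertexPos x X y Y ρ) s) := by
  have hx := h.x_pos
  have hX := h.X_pos
  have hy := h.y_pos
  have hY := h.Y_pos
  have hρ := h.ρ_pos
  -- The inner products of this vector with the vertices are 1, 3X, XY/ρ, Y, 1.
  refine _root_.isCompact_cell (w := !₂[1, 2 * X / x, -(2 * Y / y), 1]) (fun i => ?_) s
  rw [h.coe_vertexPos]
  fin_cases i <;> simp [vertexVec, PiLp.inner_apply, Fin.sum_univ_four]
  · have : x * (2 * X / x) = 2 * X := by field_simp
    linarith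
  · rw [← sub_pos]
    have : X * Y / ρ + x * Y / ρ * (2 * X / x) - X * y / ρ * (2 * Y / y) = X * Y / ρ := by
      field_simp; ring
    rw [this]; positivity
  · have : y * (2 * Y / y) = 2 * Y := by field_simp
    linarith

lemma isCompact_surface : IsCompact (pyramid.surface (vertexPos x X y Y ρ)) :=
  pyramid.faces.finite_toSet.isCompact_biUnion fun _ _ => h.isCompact_cell _

end Admissible

/-! ### Homeomorphism with the 2-sphere -/

/-- The linear projection of `ℝ⁴` to `ℝ³` along an interior point of the triangle `134`. -/
def axialProj (x X y Y : ℝ) (v : E4) : EuclideanSpace ℝ (Fin 3) :=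
  !₂[v 0, v 1 - x / X * v 3, v 2 + y / Y * v 3]

lemma axialProj_smul (x X y Y r : ℝ) (v : E4) :
    axialProj x X y Y (r • v) = r • axialProj x X y Y v := by
  ext i
  fin_cases i <;> simp [axialProj] <;> ring

lemma continuous_axialProj (x X y Y : ℝ) : Continuous (axialProj x X y Y) := by
  refine (PiLp.continuous_toLp 2 _).comp (continuous_pi fun i => ?_)
  fin_cases i <;> simp <;> fun_prop

namespace Admissible

variable {x X y Y ρ : ℝ} (h : Admissible x X y Y ρ)
include h

/-- The kernel of the projection is spanned by p₁/X + p₃/Y + p₄, which adds a second relation to the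
first. The alternatives at `0`, `2` rule out a multiple of the first relation by its signs; those at
`1`, `3`, `4` then rule out a multiple of the second. -/
lemma coeff_unique_of_axialProj {c c' : Fin 5 → ℝ} (hc0 : ∀ i, 0 ≤ c i) (hc0' : ∀ i, 0 ≤ c' i)
    (hs : c 0 = 0 ∨ c 2 = 0) (hs' : c' 0 = 0 ∨ c' 2 = 0)
    (ht : c 1 = 0 ∨ c 3 = 0 ∨ c 4 = 0) (ht' : c' 1 = 0 ∨ c' 3 = 0 ∨ c' 4 = 0)
    (hc : axialProj x X y Y (∑ i, c i • (vertexPos x X y Y ρ i : E4)) =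
      axialProj x X y Y (∑ i, c' i • (vertexPos x X y Y ρ i : E4))) : c = c' := by
  have hX := h.X_pos
  have hY := h.Y_pos
  set l := c 4 - c' 4 with hl
  have hsum : ∑ i, c i • (vertexPos x X y Y ρ i : E4) =
      ∑ i, (c' + l • ![0, 1 / X, 0, 1 / Y, 1]) i • (vertexPos x X y Y ρ i : E4) := by
    rw [h.sum_vertexPos, h.sum_vertexPos] at hc ⊢
    have h0 := congr($hc 0)
    have h1 := congr($hc 1)
    have h2 := congr($hc 2)
    simp [axialProj] at h0 h1 h2
    ext i
    fin_cases i <;> simp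
    · field_simp
      field_simp at h0
      linarith
    · linear_combination h1 + x / X * hl
    · linear_combination h2 - y / Y * hl
    · linarith
  obtain ⟨κ, e0, e1, e2, e3, e4⟩ := h.exists_of_sum_eq hsum
  simp at e0 e1 e2 e3 e4
  have hXY := mul_pos hX hY
  have hρ := h.ρ_pos
  have hκ : κ = 0 := by
    rcases lt_trichotomy κ 0 with hκ | hκ | hκ
    · have := mul_neg_of_neg_of_pos hκ hXY
      have := mul_neg_of_neg_of_pos hκ hρ
      rcases hs' with hs' | hs' <;> linarith [hc0 0, hc0 2]
    · exact hκ
    · have := mul_pos hκ hXY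
      have := mul_pos hκ hρ
      rcases hs with hs | hs <;> linarith [hc0' 0, hc0' 2]
  subst hκ
  have hl0 : l = 0 := by
    have iX := inv_pos.2 hX
    have iY := inv_pos.2 hY
    rcases lt_trichotomy l 0 with hl' | hl' | hl'
    · have := mul_neg_of_neg_of_pos hl' iX
      have := mul_neg_of_neg_of_pos hl' iY
      rcases ht' with ht' | ht' | ht' <;> linarith [hc0 1, hc0 3, hc0 4]
    · exact hl'
    · have := mul_pos hl' iX
      have := mul_pos hl' iY
      rcases ht with ht | ht | ht <;> linarith [hc0' 1, hc0' 3, hc0' 4]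
  rw [hl0] at e1 e3 e4
  ext i
  fin_cases i <;> simp_all

/-- The projected cones cover ℝ³. Start from the coefficients with c₂ = c₄ = 0, add κ ≥ 0 times the
first relation until c₀ and c₂ are nonnegative and one of them vanishes, then add l ≥ 0 times the
second until the same holds for c₁, c₃, c₄. -/
lemma exists_coeff_of_axialProj (v : EuclideanSpace ℝ (Fin 3)) : ∃ c : Fin 5 → ℝ,
    (∀ i, 0 ≤ c i) ∧ (c 0 = 0 ∨ c 2 = 0) ∧ (c 1 = 0 ∨ c 3 = 0 ∨ c 4 = 0) ∧
      axialProj x X y Y (∑ i, c i • (vertexPos x X y Y ρ i : E4)) = v := by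
  have hx := h.x_pos
  have hX := h.X_pos
  have hy := h.y_pos
  have hY := h.Y_pos
  have hρ := h.ρ_pos
  obtain ⟨a, ha⟩ : ∃ a, a = v 0 - X * v 1 / x - Y * v 2 / y := ⟨_, rfl⟩
  obtain ⟨κ, h1, h2, h3⟩ : ∃ κ : ℝ, 0 ≤ κ ∧ 0 ≤ a + κ * (X * Y) ∧
      (a + κ * (X * Y) = 0 ∨ κ * ρ = 0) := by
    rcases le_total 0 a with ha | ha
    · exact ⟨0, by simp, by simpa using ha, by simp⟩
    · have : a + -a / (X * Y) * (X * Y) = 0 := by field_simp; ring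
      exact ⟨-a / (X * Y), div_nonneg (by linarith) (by positivity), this.ge, .inl this⟩
  obtain ⟨b, hb⟩ : ∃ b, b = v 1 / x - κ * Y := ⟨_, rfl⟩
  obtain ⟨d, hd⟩ : ∃ d, d = -(v 2 / y) + κ * X := ⟨_, rfl⟩
  obtain ⟨l, h4, h5, h6, h7⟩ : ∃ l : ℝ, 0 ≤ l ∧ 0 ≤ b + l / X ∧ 0 ≤ d + l / Y ∧
      (b + l / X = 0 ∨ d + l / Y = 0 ∨ l = 0) := by
    have e1 (l : ℝ) : b + l / X = (l - -X * b) / X := by field_simp; ring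
    have e2 (l : ℝ) : d + l / Y = (l - -Y * d) / Y := by field_simp; ring
    obtain ⟨l, h4, h5, h6, h7⟩ : ∃ l : ℝ, 0 ≤ l ∧ -X * b ≤ l ∧ -Y * d ≤ l ∧
        (l = -X * b ∨ l = -Y * d ∨ l = 0) := by
      rcases le_total (-X * b) (-Y * d) with h' | h'
      · rcases le_total (-Y * d) 0 with h'' | h''
        · exact ⟨0, le_rfl, h'.trans h'', h'', by simp⟩
        · exact ⟨-Y * d, h'', h', le_rfl, by simp⟩
      · rcases le_total (-X * b) 0 with h'' | h''
        · exact ⟨0, le_rfl, h'', h'.trans h'', by simp⟩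
        · exact ⟨-X * b, h'', le_rfl, h', by simp⟩
    refine ⟨l, h4, ?_, ?_, h7.imp ?_ (Or.imp_left ?_)⟩
    · rw [e1]
      exact div_nonneg (sub_nonneg.2 h5) hX.le
    · rw [e2]
      exact div_nonneg (sub_nonneg.2 h6) hY.le
    · rintro h'
      rw [e1, h', sub_self, zero_div]
    · rintro h'
      rw [e2, h', sub_self, zero_div]
  refine ⟨![a + κ * (X * Y), b + l / X, κ * ρ, d + l / Y, l], ?_, h3, h7, ?_⟩
  · intro i
    fin_cases i
    exacts [h2, h5, mul_nonneg h1 hρ.le, h6, h4]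
  · rw [h.sum_vertexPos]
    ext i
    fin_cases i <;> simp [axialProj, ha, hb, hd] <;> field_simp <;> ring

/-- Project along the axis through the triangle `134`, then normalize. Existence and uniqueness of
coefficients make this a continuous bijection from a compact space onto S². -/
lemma sphereHomeomorphic : pyramid.SphereHomeomorphic (vertexPos x X y Y ρ) := by
  set p := vertexPos x X y Y ρ with hp
  have hne (z : pyramid.surface p) : axialProj x X y Y (z : S3) ≠ 0 := by
    intro h0
    obtain ⟨c, hc, hs, ht, e⟩ := mem_pyramid_surface_iff.1 z.2
    have : c = 0 := by
      refine h.coeff_unique_of_axialProj hc (fun _ => le_rfl) hs (by simp) ht (by simp) ?_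
      rw [← hp, ← e, h0]
      ext i
      fin_cases i <;> simp [axialProj]
    have h1 : ‖((z : S3) : E4)‖ = 1 := by simp
    rw [e] at h1
    simp [this] at h1
  have : CompactSpace (pyramid.surface p) := isCompact_iff_compactSpace.1 h.isCompact_surface
  let f : pyramid.surface p → S2 := fun z =>
    ⟨‖axialProj x X y Y (z : S3)‖⁻¹ • axialProj x X y Y (z : S3), by simp [norm_smul, hne z]⟩
  have hf : Continuous f := by
    have hc : Continuous fun z : pyramid.surface p => axialProj x X y Y (z : S3) :=
      (continuous_axialProj x X y Y).comp (by fun_prop)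
    exact ((hc.norm.inv₀ fun z => norm_ne_zero_iff.2 (hne z)).smul hc).subtype_mk _
  have hinj : Function.Injective f := by
    intro z z' hzz
    obtain ⟨c, hc, hs, ht, e⟩ := mem_pyramid_surface_iff.1 z.2
    obtain ⟨c', hc', hs', ht', e'⟩ := mem_pyramid_surface_iff.1 z'.2
    have hzz' := congr_arg Subtype.val hzz
    simp only [f] at hzz'
    have hn := norm_pos_iff.2 (hne z)
    have hn' := norm_pos_iff.2 (hne z')
    set r := ‖axialProj x X y Y (z : S3)‖ with hr
    set r' := ‖axialProj x X y Y (z' : S3)‖ with hr'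
    have hcc : r⁻¹ • c = r'⁻¹ • c' := by
      refine h.coeff_unique_of_axialProj (fun i => mul_nonneg (inv_pos.2 hn).le (hc i))
        (fun i => mul_nonneg (inv_pos.2 hn').le (hc' i)) (hs.imp ?_ ?_) (hs'.imp ?_ ?_)
        (ht.imp ?_ (Or.imp ?_ ?_)) (ht'.imp ?_ (Or.imp ?_ ?_)) ?_
      iterate 10 exact fun h => by simp [h]
      simp only [Pi.smul_apply, smul_assoc, ← Finset.smul_sum, ← hp, ← e, ← e', axialProj_smul]
      exact hzz'
    have hz : r⁻¹ • ((z : S3) : E4) = r'⁻¹ • ((z' : S3) : E4) := by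
      have := congr_arg (fun c : Fin 5 → ℝ => ∑ i, c i • (p i : E4)) hcc
      simpa only [Pi.smul_apply, smul_assoc, ← Finset.smul_sum, ← e, ← e'] using this
    have hrr : r⁻¹ = r'⁻¹ := by
      have := congr_arg norm hz
      simpa [norm_smul, abs_of_pos, hn, hn'] using this
    rw [hrr] at hz
    exact Subtype.ext (Subtype.ext (smul_right_injective _ (inv_pos.2 hn').ne' hz))
  have hsurj : Function.Surjective f := by
    intro v
    obtain ⟨c, hc, hs, ht, e⟩ := h.exists_coeff_of_axialProj (v : EuclideanSpace ℝ (Fin 3))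
    set w := ∑ i, c i • (vertexPos x X y Y ρ i : E4) with hw
    have hv : ‖(v : EuclideanSpace ℝ (Fin 3))‖ = 1 := by simp
    have hw0 : w ≠ 0 := by
      intro h0
      have : axialProj x X y Y 0 = 0 := by
        ext i
        fin_cases i <;> simp [axialProj]
      rw [h0, this] at e
      simp [← e] at hv
    have hn := norm_pos_iff.2 hw0
    refine ⟨⟨⟨‖w‖⁻¹ • w, by simp [norm_smul, hn.ne']⟩, mem_pyramid_surface_iff.2
      ⟨‖w‖⁻¹ • c, fun i => mul_nonneg (inv_pos.2 hn).le (hc i), hs.imp ?_ ?_,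
        ht.imp ?_ (Or.imp ?_ ?_), ?_⟩⟩, ?_⟩
    iterate 5 exact fun h => by simp [h]
    · simp only [Pi.smul_apply, smul_assoc, ← Finset.smul_sum]
      rw [hw]
    · apply Subtype.ext
      simp [f, axialProj_smul, e, norm_smul, hv, smul_smul, hn.ne']
  exact ⟨(hf.isClosedEmbedding hinj).toHomeomorphOfSurjective hsurj⟩

end Admissible

end

/-! ### Dihedral angles -/

noncomputable section

open Set

lemma perp_smul_add {A : Set E4} {f y : E4} (r : ℝ) (hf : ∀ a ∈ A, inner ℝ a f = 0)
    (hy : y ∈ Submodule.span ℝ A) : perp A (r • f + y) = r • f := by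
  have hf' : r • f ∈ (Submodule.span ℝ A)ᗮ := by
    refine Submodule.smul_mem _ _ ?_
    rw [Submodule.mem_orthogonal]
    intro u hu
    induction hu using Submodule.span_induction with
    | mem a ha => exact hf a ha
    | zero => simp
    | add a b _ _ ha hb => rw [inner_add_left, ha, hb, add_zero]
    | smul c a _ ha => rw [inner_smul_left, ha, mul_zero]
  rw [perp, map_add, Submodule.starProjection_eq_self_iff.2 hf',
    (Submodule.starProjection_apply_eq_zero_iff _).2 (Submodule.le_orthogonal_orthogonal _ hy),
    add_zero]

/-- Projecting away from the edge only rescales `f` and `g` by positive factors, so explicit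
decompositions replace the computation of projections. -/
lemma angle_perp_pair {u v w w' f g : E4} {r s a b a' b' : ℝ} (hr : 0 < r) (hs : 0 < s)
    (hfu : inner ℝ u f = 0) (hfv : inner ℝ v f = 0) (hgu : inner ℝ u g = 0)
    (hgv : inner ℝ v g = 0) (hw : w = r • f + (a • u + b • v))
    (hw' : w' = s • g + (a' • u + b' • v)) :
    InnerProductGeometry.angle (perp {u, v} w) (perp {u, v} w') =
      InnerProductGeometry.angle f g := by
  have hspan (a b : ℝ) : a • u + b • v ∈ Submodule.span ℝ {u, v} :=
    Submodule.mem_span_pair.2 ⟨a, b, rfl⟩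
  rw [hw, hw', perp_smul_add r (by simp [hfu, hfv]) (hspan a b),
    perp_smul_add s (by simp [hgu, hgv]) (hspan a' b'),
    InnerProductGeometry.angle_smul_left_of_pos _ _ hr,
    InnerProductGeometry.angle_smul_right_of_pos _ _ hs]

lemma planeAngle_eq_edgeLength {u v w : S3} (hv : inner ℝ (u : E4) (v : E4) = 0)
    (hw : inner ℝ (u : E4) (w : E4) = 0) : planeAngle u v w = edgeLength v w := by
  have h0 := Submodule.zero_mem (Submodule.span ℝ {(u : E4)})
  have e1 := perp_smul_add (A := {(u : E4)}) (f := (v : E4)) (y := 0) 1 (by simpa using hv) h0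
  have e2 := perp_smul_add (A := {(u : E4)}) (f := (w : E4)) (y := 0) 1 (by simpa using hw) h0
  simp only [one_smul, add_zero] at e1 e2
  rw [planeAngle, e1, e2, edgeLength]

lemma det4_eq (u v w z : E4) : det4 u v w z =
    u 0 * (v 1 * (w 2 * z 3 - w 3 * z 2) - v 2 * (w 1 * z 3 - w 3 * z 1) +
      v 3 * (w 1 * z 2 - w 2 * z 1)) -
    u 1 * (v 0 * (w 2 * z 3 - w 3 * z 2) - v 2 * (w 0 * z 3 - w 3 * z 0) +
      v 3 * (w 0 * z 2 - w 2 * z 0)) +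
    u 2 * (v 0 * (w 1 * z 3 - w 3 * z 1) - v 1 * (w 0 * z 3 - w 3 * z 0) +
      v 3 * (w 0 * z 1 - w 1 * z 0)) -
    u 3 * (v 0 * (w 1 * z 2 - w 2 * z 1) - v 1 * (w 0 * z 2 - w 2 * z 0) +
      v 2 * (w 0 * z 1 - w 1 * z 0)) := by
  rw [det4, Matrix.det_succ_row_zero]
  simp [Fin.sum_univ_succ, Matrix.det_fin_three, Fin.succAbove]
  ring

/-- The dihedral angles of the pyramid. -/
def pyramidDihedral (h : Fin 5 × Fin 5 × Fin 5 × Fin 5) : ℝ :=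
  if h = (1, 3, 2, 0) then Real.pi
  else if h = (1, 4, 0, 2) then 2 * Real.pi - Real.pi / 2
  else if h = (2, 4, 1, 3) then Real.arccos (12 / 25)
  else Real.pi / 2

lemma pyramid_hinges : pyramid.hinges = {(0, 1, 4, 3), (0, 3, 1, 4), (0, 4, 3, 1), (1, 2, 4, 3),
    (1, 3, 2, 0), (1, 4, 0, 2), (2, 3, 4, 1), (2, 4, 1, 3), (3, 4, 2, 0)} := by
  decide +kernel

namespace Admissible

variable {x X y Y ρ : ℝ} (h : Admissible x X y Y ρ)
include h

lemma dihedralAngle_eq_of_nonneg {i j k l : Fin 5} {f g : E4} (r s a b a' b' : ℝ) {φ : ℝ}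
    (hr : 0 < r) (hs : 0 < s)
    (hfu : inner ℝ (vertexVec x X y Y ρ i) f = 0) (hfv : inner ℝ (vertexVec x X y Y ρ j) f = 0)
    (hgu : inner ℝ (vertexVec x X y Y ρ i) g = 0) (hgv : inner ℝ (vertexVec x X y Y ρ j) g = 0)
    (hw : vertexVec x X y Y ρ k =
      r • f + (a • vertexVec x X y Y ρ i + b • vertexVec x X y Y ρ j))
    (hw' : vertexVec x X y Y ρ l =
      s • g + (a' • vertexVec x X y Y ρ i + b' • vertexVec x X y Y ρ j))
    (hd : 0 ≤ det4 (vertexVec x X y Y ρ i) (vertexVec x X y Y ρ j) (vertexVec x X y Y ρ k)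
      (vertexVec x X y Y ρ l))
    (hφ : InnerProductGeometry.angle f g = φ) :
    OrientedTriangulation.dihedralAt (vertexPos x X y Y ρ) (i, j, k, l) = φ := by
  simp only [OrientedTriangulation.dihedralAt, dihedralAngle, h.coe_vertexPos]
  rw [if_pos hd, angle_perp_pair hr hs hfu hfv hgu hgv hw hw', hφ]

lemma dihedralAngle_eq_of_neg {i j k l : Fin 5} {f g : E4} (r s a b a' b' : ℝ) {φ : ℝ}
    (hr : 0 < r) (hs : 0 < s)
    (hfu : inner ℝ (vertexVec x X y Y ρ i) f = 0) (hfv : inner ℝ (vertexVec x X y Y ρ j) f = 0)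
    (hgu : inner ℝ (vertexVec x X y Y ρ i) g = 0) (hgv : inner ℝ (vertexVec x X y Y ρ j) g = 0)
    (hw : vertexVec x X y Y ρ k =
      r • f + (a • vertexVec x X y Y ρ i + b • vertexVec x X y Y ρ j))
    (hw' : vertexVec x X y Y ρ l =
      s • g + (a' • vertexVec x X y Y ρ i + b' • vertexVec x X y Y ρ j))
    (hd : det4 (vertexVec x X y Y ρ i) (vertexVec x X y Y ρ j) (vertexVec x X y Y ρ k)
      (vertexVec x X y Y ρ l) < 0)
    (hφ : InnerProductGeometry.angle f g = φ) :
    OrientedTriangulation.dihedralAt (vertexPos x X y Y ρ) (i, j, k, l) = 2 * Real.pi - φ := by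
  simp only [OrientedTriangulation.dihedralAt, dihedralAngle, h.coe_vertexPos]
  rw [if_neg (not_le.2 hd), angle_perp_pair hr hs hfu hfv hgu hgv hw hw', hφ]

/-- For each edge, `f` and `g` are directions normal to it, pointing into the two adjacent
triangles. -/
lemma dihedralAt_eq : ∀ e ∈ pyramid.hinges,
    OrientedTriangulation.dihedralAt (vertexPos x X y Y ρ) e = pyramidDihedral e := by
  have hx := h.x_pos
  have hX := h.X_pos
  have hy := h.y_pos
  have hY := h.Y_pos
  have hρ := h.ρ_pos
  have hx2 := h.x_sq
  have hy2 := h.y_sq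
  have hρ2 := h.ρ_sq
  have hq : 0 < y ^ 2 + x ^ 2 * Y ^ 2 := by positivity
  -- This is the squared norm of the normal direction used at the diagonal `13`.
  obtain ⟨q, hq'⟩ : ∃ q, q = y ^ 2 + x ^ 2 * Y ^ 2 := ⟨_, rfl⟩
  rw [← hq'] at hq
  have hangle {f g : E4} (hfg : inner ℝ f g = 0) : InnerProductGeometry.angle f g = Real.pi / 2 :=
    (InnerProductGeometry.inner_eq_zero_iff_angle_eq_pi_div_two _ _).1 hfg
  rw [pyramid_hinges]
  simp only [Finset.mem_insert, Finset.mem_singleton, forall_eq_or_imp, forall_eq]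
  refine ⟨?_, ?_, ?_, ?_, ?_, ?_, ?_, ?_, ?_⟩
  · refine h.dihedralAngle_eq_of_nonneg (f := !₂[0, 0, 0, 1]) (g := !₂[0, 0, -1, 0])
      1 y 0 0 (-Y) 0 one_pos hy ?_ ?_ ?_ ?_ ?_ ?_ ?_ (hangle ?_)
    iterate 4 · simp [vertexVec, PiLp.inner_apply, Fin.sum_univ_four]
    iterate 2 · ext i; fin_cases i <;> simp [vertexVec]
    · simp [det4_eq, vertexVec]; positivity
    · simp [PiLp.inner_apply, Fin.sum_univ_four]
  · refine h.dihedralAngle_eq_of_nonneg (f := !₂[0, 1, 0, 0]) (g := !₂[0, 0, 0, 1])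
      x 1 X 0 0 0 hx one_pos ?_ ?_ ?_ ?_ ?_ ?_ ?_ (hangle ?_)
    iterate 4 · simp [vertexVec, PiLp.inner_apply, Fin.sum_univ_four]
    iterate 2 · ext i; fin_cases i <;> simp [vertexVec]
    · simp [det4_eq, vertexVec]; positivity
    · simp [PiLp.inner_apply, Fin.sum_univ_four]
  · refine h.dihedralAngle_eq_of_nonneg (f := !₂[0, 0, -1, 0]) (g := !₂[0, 1, 0, 0])
      y x (-Y) 0 X 0 hy hx ?_ ?_ ?_ ?_ ?_ ?_ ?_ (hangle ?_)
    iterate 4 · simp [vertexVec, PiLp.inner_apply, Fin.sum_univ_four]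
    iterate 2 · ext i; fin_cases i <;> simp [vertexVec]
    · simp [det4_eq, vertexVec]; positivity
    · simp [PiLp.inner_apply, Fin.sum_univ_four]
  · refine h.dihedralAngle_eq_of_nonneg (f := !₂[0, 0, 0, 1]) (g := !₂[-x, X, 0, 0])
      1 (x * Y) 0 0 (x ^ 2 * Y / X) (-(ρ / X)) one_pos (by positivity)
      ?_ ?_ ?_ ?_ ?_ ?_ ?_ (hangle ?_)
    iterate 4 · simp [vertexVec, PiLp.inner_apply, Fin.sum_univ_four] <;> ring
    iterate 2 · ext i; fin_cases i <;> simp [vertexVec] <;> field_simp <;> grind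
    · simp [det4_eq, vertexVec]; field_simp; ring_nf; positivity
    · simp [PiLp.inner_apply, Fin.sum_univ_four]
  -- The diagonal `13`: the base is flat, the two directions are opposite and the determinant is 0.
  · refine h.dihedralAngle_eq_of_nonneg (f := !₂[-(x * y), X * y, x * Y, 0])
      (g := -!₂[-(x * y), X * y, x * Y, 0])
      (X * Y / ρ * (x * y / q)) (x * y / q) (Y / ρ - X * Y / ρ * (X * y ^ 2 / q))
      (-(X / ρ) + X * Y / ρ * (x ^ 2 * Y / q)) (X * y ^ 2 / q) (-(x ^ 2 * Y / q))
      (by positivity) (by positivity)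
      ?_ ?_ ?_ ?_ ?_ ?_ ?_ (InnerProductGeometry.angle_self_neg_of_nonzero ?_)
    iterate 4 · simp [vertexVec, PiLp.inner_apply, Fin.sum_univ_four] <;> ring
    iterate 2 · ext i; fin_cases i <;> simp [vertexVec] <;> field_simp <;> grind
    · simp [det4_eq, vertexVec]
    · intro h0
      simpa [hX.ne', hy.ne'] using congr($h0 1)
  -- The reflex edge `14`, the only one with negative determinant.
  · refine h.dihedralAngle_eq_of_neg (f := !₂[x, -X, 0, 0]) (g := !₂[0, 0, 1, 0])
      x (X * y / ρ) X 0 (Y / ρ) 0 hx (by positivity)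
      ?_ ?_ ?_ ?_ ?_ ?_ ?_ (hangle ?_)
    iterate 4 · simp [vertexVec, PiLp.inner_apply, Fin.sum_univ_four] <;> ring
    iterate 2 · ext i; fin_cases i <;> simp [vertexVec] <;> field_simp <;> grind
    · simp [det4_eq, vertexVec]; positivity
    · simp [PiLp.inner_apply, Fin.sum_univ_four]
  · refine h.dihedralAngle_eq_of_nonneg (f := !₂[0, 0, 0, 1]) (g := !₂[y, 0, -Y, 0])
      1 (X * y) 0 0 (ρ / Y) (X * y ^ 2 / Y) one_pos (by positivity)
      ?_ ?_ ?_ ?_ ?_ ?_ ?_ (hangle ?_)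
    iterate 4 · simp [vertexVec, PiLp.inner_apply, Fin.sum_univ_four] <;> ring
    iterate 2 · ext i; fin_cases i <;> simp [vertexVec] <;> field_simp <;> grind
    · simp [det4_eq, vertexVec]; field_simp; ring_nf; positivity
    · simp [PiLp.inner_apply, Fin.sum_univ_four]
  -- The edge `24`: both directions have norm ρ and their inner product is xyρ², so the cosine is xy
  -- = 12/25.
  · refine h.dihedralAngle_eq_of_nonneg (f := !₂[X ^ 2 * y, x * X * y, -Y, 0])
      (g := !₂[-(x * Y ^ 2), X, -(x * Y * y), 0])
      (X * y / ρ ^ 2) (x * Y / ρ ^ 2) (Y / ρ) 0 (-(X / ρ)) 0 (by positivity) (by positivity)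
      ?_ ?_ ?_ ?_ ?_ ?_ ?_ ?_
    · simp [vertexVec, PiLp.inner_apply, Fin.sum_univ_four]; field_simp; grind
    · simp [vertexVec, PiLp.inner_apply, Fin.sum_univ_four]
    · simp [vertexVec, PiLp.inner_apply, Fin.sum_univ_four]; field_simp; grind
    · simp [vertexVec, PiLp.inner_apply, Fin.sum_univ_four]
    iterate 2 · ext i; fin_cases i <;> simp [vertexVec] <;> field_simp <;> grind
    · simp [det4_eq, vertexVec]; field_simp; ring_nf; positivity
    · have hf : ‖(!₂[X ^ 2 * y, x * X * y, -Y, 0] : E4)‖ = ρ := by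
        rw [EuclideanSpace.norm_eq, Fin.sum_univ_four, ← Real.sqrt_sq hρ.le]
        congr 1
        simp
        grind
      have hg : ‖(!₂[-(x * Y ^ 2), X, -(x * Y * y), 0] : E4)‖ = ρ := by
        rw [EuclideanSpace.norm_eq, Fin.sum_univ_four, ← Real.sqrt_sq hρ.le]
        congr 1
        simp
        grind
      rw [InnerProductGeometry.angle, hf, hg]
      simp only [pyramidDihedral]
      norm_num
      congr 1
      rw [div_eq_iff (by positivity), ← h.prod]
      simp [PiLp.inner_apply, Fin.sum_univ_four]
      grind
  · refine h.dihedralAngle_eq_of_nonneg (f := !₂[0, 1, 0, 0]) (g := !₂[y, 0, -Y, 0])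
      (x * Y / ρ) y (-(X / ρ)) 0 (-Y) 0 (by positivity) hy
      ?_ ?_ ?_ ?_ ?_ ?_ ?_ (hangle ?_)
    iterate 4 · simp [vertexVec, PiLp.inner_apply, Fin.sum_univ_four] <;> ring
    iterate 2 · ext i; fin_cases i <;> simp [vertexVec] <;> field_simp <;> grind
    · simp [det4_eq, vertexVec]; positivity
    · simp [PiLp.inner_apply, Fin.sum_univ_four]

end Admissible

end

/-! ### Edge lengths, Gauss curvature and total mean curvature -/

noncomputable section

open Set

lemma edgeLength_eq_arccos (u v : S3) :
    edgeLength u v = Real.arccos (inner ℝ (u : E4) (v : E4)) := by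
  simp [edgeLength, InnerProductGeometry.angle]

lemma pyramid_faces_apex : pyramid.faces.filter (fun f => f.1 = 4) =
    {(4, 0, 1), (4, 1, 2), (4, 2, 3), (4, 3, 0)} := by
  decide +kernel

lemma sin_arccos_sub_arccos {u v s t : ℝ} (hs : 0 ≤ s) (ht : 0 ≤ t) (hus : u ^ 2 + s ^ 2 = 1)
    (hvt : v ^ 2 + t ^ 2 = 1) : Real.sin (Real.arccos u - Real.arccos v) = s * v - u * t := by
  rw [Real.sin_sub, Real.sin_arccos, Real.sin_arccos, Real.cos_arccos, Real.cos_arccos,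
    show 1 - u ^ 2 = s ^ 2 by linarith, show 1 - v ^ 2 = t ^ 2 by linarith, Real.sqrt_sq hs,
    Real.sqrt_sq ht] <;> nlinarith

/-- The sines differ: the left side has sine 16/25 − 9/25 = 7/25, the right side 37/(125ρ²) = 5/13.
-/
lemma arccos_sub_arccos_ne {ρ : ℝ} (hρ : 0 < ρ) (hρ2 : ρ ^ 2 = 481 / 625) :
    Real.arccos (3 / 5) - Real.arccos (4 / 5) ≠
      Real.arccos (3 / 5 / ρ) - Real.arccos (4 / 5 / ρ) := by
  intro he
  have h1 := congr_arg Real.sin he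
  rw [sin_arccos_sub_arccos (s := 4 / 5) (t := 3 / 5), sin_arccos_sub_arccos (s := 16 / 25 / ρ)
    (t := 9 / 25 / ρ)] at h1
  · have : 16 / 25 / ρ * (4 / 5 / ρ) - 3 / 5 / ρ * (9 / 25 / ρ) = 37 / 125 / ρ ^ 2 := by
      field_simp; norm_num
    rw [this, hρ2] at h1
    norm_num at h1
  any_goals positivity
  any_goals (simp only [div_pow, hρ2]; norm_num)

/-- The perimeter of the quadrilateral `0123`. -/
def basePerimeter (X Y ρ : ℝ) : ℝ :=
  Real.arccos X + Real.arccos (Y / ρ) + (Real.pi - Real.arccos (X / ρ)) +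
    (Real.pi - Real.arccos Y)

/-- Interchanging X and Y reverses the sign of the variable part of the perimeter, so equality would
force that part to vanish. -/
lemma basePerimeter_ne {ρ : ℝ} (hρ : 0 < ρ) (hρ2 : ρ ^ 2 = 481 / 625) :
    basePerimeter (4 / 5) (3 / 5) ρ ≠ basePerimeter (3 / 5) (4 / 5) ρ := by
  intro he
  refine arccos_sub_arccos_ne hρ hρ2 ?_
  simp only [basePerimeter] at he
  linarith

namespace Admissible

variable {x X y Y ρ : ℝ} (h : Admissible x X y Y ρ)
include h

lemma edgeLength_apex {i : Fin 5} (hi : i ≠ 4) :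
    edgeLength (vertexPos x X y Y ρ i) (vertexPos x X y Y ρ 4) = Real.pi / 2 := by
  rw [edgeLength_eq_arccos, ← Real.arccos_zero]
  congr 1
  rw [h.coe_vertexPos, h.coe_vertexPos]
  fin_cases i <;> simp [vertexVec, PiLp.inner_apply, Fin.sum_univ_four] at hi ⊢

lemma inner_apex {i : Fin 5} (hi : i ≠ 4) :
    inner ℝ (vertexPos x X y Y ρ 4 : E4) (vertexPos x X y Y ρ i : E4) = 0 := by
  rw [h.coe_vertexPos, h.coe_vertexPos]
  fin_cases i <;> simp [vertexVec, PiLp.inner_apply, Fin.sum_univ_four] at hi ⊢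

lemma edgeLength_01 : edgeLength (vertexPos x X y Y ρ 0) (vertexPos x X y Y ρ 1) =
    Real.arccos X := by
  rw [edgeLength_eq_arccos, h.coe_vertexPos, h.coe_vertexPos]
  simp [vertexVec, PiLp.inner_apply, Fin.sum_univ_four]

lemma edgeLength_12 : edgeLength (vertexPos x X y Y ρ 1) (vertexPos x X y Y ρ 2) =
    Real.arccos (Y / ρ) := by
  rw [edgeLength_eq_arccos, h.coe_vertexPos, h.coe_vertexPos]
  congr 1
  simp [vertexVec, PiLp.inner_apply, Fin.sum_univ_four]
  linear_combination Y / ρ * h.x_sq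

lemma edgeLength_23 : edgeLength (vertexPos x X y Y ρ 2) (vertexPos x X y Y ρ 3) =
    Real.pi - Real.arccos (X / ρ) := by
  rw [edgeLength_eq_arccos, h.coe_vertexPos, h.coe_vertexPos, ← Real.arccos_neg]
  congr 1
  simp [vertexVec, PiLp.inner_apply, Fin.sum_univ_four]
  linear_combination -X / ρ * h.y_sq

lemma edgeLength_03 : edgeLength (vertexPos x X y Y ρ 0) (vertexPos x X y Y ρ 3) =
    Real.pi - Real.arccos Y := by
  rw [edgeLength_eq_arccos, h.coe_vertexPos, h.coe_vertexPos, ← Real.arccos_neg]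
  simp [vertexVec, PiLp.inner_apply, Fin.sum_univ_four]

lemma gaussCurvature_apex : pyramid.gaussCurvature (vertexPos x X y Y ρ) 4 =
    2 * Real.pi - basePerimeter X Y ρ := by
  have e {i j : Fin 5} (hi : i ≠ 4) (hj : j ≠ 4) :=
    planeAngle_eq_edgeLength (h.inner_apex hi) (h.inner_apex hj)
  have e30 : edgeLength (vertexPos x X y Y ρ 3) (vertexPos x X y Y ρ 0) =
      Real.pi - Real.arccos Y := by
    rw [← h.edgeLength_03, edgeLength, edgeLength, InnerProductGeometry.angle_comm]
  rw [OrientedTriangulation.gaussCurvature, pyramid_faces_apex]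
  simp [e, h.edgeLength_01, h.edgeLength_12, h.edgeLength_23, e30, basePerimeter]
  ring

/-- The base sides contribute with weight π/2, the diagonal not at all, and the lateral edges a
constant, since they have length π/2. -/
lemma totalMeanCurvature_eq : pyramid.totalMeanCurvature (vertexPos x X y Y ρ) =
    Real.pi / 4 * (basePerimeter X Y ρ + 3 / 2 * Real.pi - Real.arccos (12 / 25)) := by
  rw [OrientedTriangulation.totalMeanCurvature, Finset.sum_congr rfl fun e he => by
    rw [h.dihedralAt_eq e he], pyramid_hinges]
  simp [pyramidDihedral, h.edgeLength_01, h.edgeLength_12, h.edgeLength_23, h.edgeLength_03,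
    basePerimeter, h.edgeLength_apex]
  ring

end Admissible

end

/-! ### Area of sectors of a hemisphere -/

noncomputable section

open Set MeasureTheory
open scoped ENNReal

/-- In a plane, the 2-dimensional Hausdorff measure is a Haar measure and circles are null; in
smaller dimension it vanishes altogether. -/
lemma hausdorffMeasure_unit_inter_submodule {E : Type*} [NormedAddCommGroup E]
    [InnerProductSpace ℝ E] [FiniteDimensional ℝ E] [MeasurableSpace E] [BorelSpace E]
    (W : Submodule ℝ E) (hW : Module.finrank ℝ W ≤ 2) : μH[2] {x : E | ‖x‖ = 1 ∧ x ∈ W} = 0 := by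
  have e : {x : E | ‖x‖ = 1 ∧ x ∈ W} = ((↑) : W → E) '' Metric.sphere 0 1 := by
    ext x
    constructor
    · rintro ⟨h1, h2⟩
      exact ⟨⟨x, h2⟩, by simpa using h1, rfl⟩
    · rintro ⟨w, hw, rfl⟩
      exact ⟨by simpa using hw, w.2⟩
  rw [e, isometry_subtype_coe.hausdorffMeasure_image (Or.inl zero_le_two)]
  rcases hW.lt_or_eq with hW | hW
  · rw [Real.hausdorffMeasure_of_finrank_lt (by exact_mod_cast hW)]
    rfl
  · have : Measure.IsAddHaarMeasure (μH[2] : Measure W) := by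
      have := isAddHaarMeasure_hausdorffMeasure (E := W)
      rw [hW] at this
      exact_mod_cast this
    exact Measure.addHaar_sphere_of_ne_zero _ _ one_ne_zero

/-- The linear map of `ℝ³` that sends the standard basis to `u`, `v`, `w`. -/
def frameMap {E : Type*} [AddCommGroup E] [Module ℝ E] (u v w : E)
    (x : EuclideanSpace ℝ (Fin 3)) : E := x 0 • u + x 1 • v + x 2 • w

section frameMap

variable {E : Type*} [NormedAddCommGroup E] [InnerProductSpace ℝ E] {u v w : E}

lemma norm_frameMap (hu : ‖u‖ = 1) (hv : ‖v‖ = 1) (hw : ‖w‖ = 1) (huv : inner ℝ u v = 0)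
    (huw : inner ℝ u w = 0) (hvw : inner ℝ v w = 0) (x : EuclideanSpace ℝ (Fin 3)) :
    ‖frameMap u v w x‖ = ‖x‖ := by
  rw [EuclideanSpace.norm_eq, Fin.sum_univ_three, ← Real.sqrt_sq (norm_nonneg (frameMap u v w x))]
  congr 1
  have hvu : inner ℝ v u = 0 := by rw [real_inner_comm, huv]
  have hwu : inner ℝ w u = 0 := by rw [real_inner_comm, huw]
  have hwv : inner ℝ w v = 0 := by rw [real_inner_comm, hvw]
  rw [← real_inner_self_eq_norm_sq, frameMap]
  have hu' : inner ℝ u u = 1 := by rw [real_inner_self_eq_norm_sq, hu, one_pow]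
  have hv' : inner ℝ v v = 1 := by rw [real_inner_self_eq_norm_sq, hv, one_pow]
  have hw' : inner ℝ w w = 1 := by rw [real_inner_self_eq_norm_sq, hw, one_pow]
  simp [-inner_self_eq_norm_sq_to_K, inner_add_left, inner_add_right, inner_smul_left, inner_smul_right, huv, huw, hvw, hvu,
    hwu, hwv, hu', hv', hw']
  ring

lemma isometry_frameMap (hu : ‖u‖ = 1) (hv : ‖v‖ = 1) (hw : ‖w‖ = 1) (huv : inner ℝ u v = 0)
    (huw : inner ℝ u w = 0) (hvw : inner ℝ v w = 0) : Isometry (frameMap u v w) := by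
  refine Isometry.of_dist_eq fun x y => ?_
  rw [dist_eq_norm, dist_eq_norm, ← norm_frameMap hu hv hw huv huw hvw (x - y)]
  congr 1
  simp only [frameMap, PiLp.sub_apply]
  module

end frameMap

/-- The sector of the upper hemisphere with the angle `θ`. -/
def sector (θ : ℝ) : Set (EuclideanSpace ℝ (Fin 3)) :=
  {x | ‖x‖ = 1 ∧ 0 ≤ x 2 ∧ 0 ≤ x 1 ∧ 0 ≤ x 0 * Real.sin θ - x 1 * Real.cos θ}

lemma isClosed_sector (θ : ℝ) : IsClosed (sector θ) :=
  (isClosed_eq (f := fun x : EuclideanSpace ℝ (Fin 3) => ‖x‖) continuous_norm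
    continuous_const).inter ((isClosed_le (g := fun x : EuclideanSpace ℝ (Fin 3) => x 2)
    continuous_const (by fun_prop)).inter
    ((isClosed_le (g := fun x : EuclideanSpace ℝ (Fin 3) => x 1)
    continuous_const (by fun_prop)).inter
    (isClosed_le (g := fun x : EuclideanSpace ℝ (Fin 3) => x 0 * Real.sin θ - x 1 * Real.cos θ)
    continuous_const (by fun_prop))))

lemma sq_add_sq_add_sq {x : EuclideanSpace ℝ (Fin 3)} (hx : ‖x‖ = 1) :
    x 0 ^ 2 + x 1 ^ 2 + x 2 ^ 2 = 1 := by
  have := EuclideanSpace.norm_sq_eq x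
  rw [hx, Fin.sum_univ_three] at this
  simpa using this.symm

lemma norm_eq_one_of_sq_three {v : EuclideanSpace ℝ (Fin 3)}
    (h : v 0 ^ 2 + v 1 ^ 2 + v 2 ^ 2 = 1) : ‖v‖ = 1 := by
  rw [EuclideanSpace.norm_eq, Fin.sum_univ_three]
  simp [h]

/-- Great circles have no area. -/
lemma hausdorffMeasure_greatCircle {n : EuclideanSpace ℝ (Fin 3)} (hn : n ≠ 0) :
    μH[2] {x : EuclideanSpace ℝ (Fin 3) | ‖x‖ = 1 ∧ inner ℝ n x = 0} = 0 := by
  have hW : Module.finrank ℝ (ℝ ∙ n)ᗮ ≤ 2 := by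
    have : Fact (Module.finrank ℝ (EuclideanSpace ℝ (Fin 3)) = 2 + 1) := ⟨by simp⟩
    exact (Submodule.finrank_orthogonal_span_singleton hn).le
  refine measure_mono_null ?_ (hausdorffMeasure_unit_inter_submodule _ hW)
  rintro x ⟨h1, h2⟩
  exact ⟨h1, Submodule.mem_orthogonal_singleton_iff_inner_right.2 h2⟩

/-- Longitude and latitude parametrize the sphere by a map that is Lipschitz on a compact square. -/
lemma hausdorffMeasure_unitSphere_lt_top :
    μH[2] {x : EuclideanSpace ℝ (Fin 3) | ‖x‖ = 1} < ∞ := by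
  let f : ℝ × ℝ → EuclideanSpace ℝ (Fin 3) := fun a =>
    !₂[Real.cos a.1 * Real.cos a.2, Real.sin a.1 * Real.cos a.2, Real.sin a.2]
  let s : Set (ℝ × ℝ) := Icc (-Real.pi) Real.pi ×ˢ Icc (-Real.pi) Real.pi
  have hf : ContDiff ℝ 1 f := by
    rw [contDiff_piLp]
    intro i
    fin_cases i <;> simp [f] <;> fun_prop
  obtain ⟨K, hK⟩ := hf.contDiffOn.exists_lipschitzOnWith (s := s) one_ne_zero
    ((convex_Icc _ _).prod (convex_Icc _ _)) (isCompact_Icc.prod isCompact_Icc)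
  have hsub : {x : EuclideanSpace ℝ (Fin 3) | ‖x‖ = 1} ⊆ f '' s := by
    intro x hx
    have hx' := sq_add_sq_add_sq hx
    have h2 : x 2 ∈ Icc (-1 : ℝ) 1 := abs_le.1 (abs_le_one_iff_mul_self_le_one.2 (by nlinarith))
    let z : ℂ := ⟨x 0, x 1⟩
    have hz : ‖z‖ = Real.cos (Real.arcsin (x 2)) := by
      rw [Real.cos_arcsin, Complex.norm_def, Complex.normSq_mk]
      congr 1
      linarith
    refine ⟨(Complex.arg z, Real.arcsin (x 2)), ⟨⟨(Complex.neg_pi_lt_arg z).le,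
      Complex.arg_le_pi z⟩, ?_⟩, ?_⟩
    · have := Real.pi_pos
      constructor
      · linarith [Real.neg_pi_div_two_le_arcsin (x 2)]
      · linarith [Real.arcsin_le_pi_div_two (x 2)]
    · ext i
      fin_cases i
      · exact (mul_comm _ _).trans ((hz ▸ Complex.norm_mul_cos_arg z :))
      · exact (mul_comm _ _).trans ((hz ▸ Complex.norm_mul_sin_arg z :))
      · simp [f, Real.sin_arcsin h2.1 h2.2]
  refine (measure_mono hsub).trans_lt ((hK.hausdorffMeasure_image_le zero_le_two).trans_lt ?_)
  rw [hausdorffMeasure_prod_real]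
  refine ENNReal.mul_lt_top (by simp) ?_
  exact (isCompact_Icc.prod isCompact_Icc).measure_lt_top

/-- The area of a sector. -/
def sectorArea (θ : ℝ) : ℝ := (μH[2] (sector θ)).toReal

lemma hausdorffMeasure_sector_ne_top (θ : ℝ) : μH[2] (sector θ) ≠ ∞ :=
  ((measure_mono fun _ hx => hx.1).trans_lt hausdorffMeasure_unitSphere_lt_top).ne

/-- The orthogonal projection to the equatorial plane is 1-Lipschitz and the image of the sector
contains a nonempty open set. -/
lemma sectorArea_pos {θ : ℝ} (h0 : 0 < θ) (h1 : θ ≤ Real.pi) : 0 < sectorArea θ := by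
  refine ENNReal.toReal_pos ?_ (hausdorffMeasure_sector_ne_top θ)
  let f : EuclideanSpace ℝ (Fin 3) → ℝ × ℝ := fun x => (x 0, x 1)
  have hf : LipschitzWith 1 f := by
    refine LipschitzWith.of_dist_le_mul fun x y => ?_
    rw [NNReal.coe_one, one_mul, Prod.dist_eq, dist_eq_norm x y]
    exact max_le (PiLp.norm_apply_le (x - y) 0) (PiLp.norm_apply_le (x - y) 1)
  let O : Set (ℝ × ℝ) := {q | 0 < q.2} ∩
    ({q | 0 < q.1 * Real.sin θ - q.2 * Real.cos θ} ∩ {q | q.1 ^ 2 + q.2 ^ 2 < 1})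
  have hO : IsOpen O := (isOpen_lt continuous_const (by fun_prop)).inter
    ((isOpen_lt continuous_const (by fun_prop)).inter (isOpen_lt (by fun_prop) continuous_const))
  have hsin : 0 < Real.sin (θ / 2) := Real.sin_pos_of_pos_of_lt_pi (by linarith) (by linarith)
  have hne : O.Nonempty := by
    refine ⟨(Real.cos (θ / 2) / 2, Real.sin (θ / 2) / 2), ?_, ?_, ?_⟩
    · simpa using hsin
    · have : Real.sin (θ - θ / 2) = Real.sin (θ / 2) := by congr 1; ring
      rw [Real.sin_sub] at this
      simp only [mem_ofPred_eq]
      linarith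
    · have := Real.sin_sq_add_cos_sq (θ / 2)
      simp only [mem_ofPred_eq]
      linarith
  have hsub : O ⊆ f '' sector θ := by
    rintro ⟨a, b⟩ ⟨hb, hab, hr⟩
    simp only [mem_ofPred_eq] at hb hab hr
    refine ⟨!₂[a, b, √(1 - a ^ 2 - b ^ 2)], ⟨norm_eq_one_of_sq_three ?_, ?_, ?_, ?_⟩, ?_⟩
    · simp [Real.sq_sqrt (show 0 ≤ 1 - a ^ 2 - b ^ 2 by linarith)]
    · simp
    · simpa using hb.le
    · simpa using hab.le
    · simp [f]
  intro h
  have h2 := (measure_mono hsub).trans (hf.hausdorffMeasure_image_le zero_le_two (sector θ))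
  rw [h, hausdorffMeasure_prod_real, mul_zero] at h2
  exact (hO.measure_pos volume hne).ne' (nonpos_iff_eq_zero.1 h2)

/-- Rotate the second sector by θ about the pole; the two then overlap only in a great circle.
Additivity and positivity give all that is needed about areas of sectors, so no area has to be
evaluated. -/
lemma sectorArea_add {θ φ : ℝ} (hθ : 0 < θ) (hφ : 0 < φ) (hs : θ + φ ≤ Real.pi) :
    sectorArea (θ + φ) = sectorArea θ + sectorArea φ := by
  have hsθ := Real.sin_pos_of_pos_of_lt_pi hθ (by linarith)
  have hsφ := Real.sin_pos_of_pos_of_lt_pi hφ (by linarith)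
  have hss := Real.sin_nonneg_of_nonneg_of_le_pi (by linarith) hs
  set u : EuclideanSpace ℝ (Fin 3) := !₂[Real.cos θ, Real.sin θ, 0] with hu
  set v : EuclideanSpace ℝ (Fin 3) := !₂[-Real.sin θ, Real.cos θ, 0] with hv
  set w : EuclideanSpace ℝ (Fin 3) := !₂[0, 0, 1] with hw
  have hcs := Real.sin_sq_add_cos_sq θ
  have nu : ‖u‖ = 1 := norm_eq_one_of_sq_three (by simp [hu])
  have nv : ‖v‖ = 1 := norm_eq_one_of_sq_three (by simp [hv])
  have nw : ‖w‖ = 1 := norm_eq_one_of_sq_three (by simp [hw])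
  have huv : inner ℝ u v = 0 := by
    simp [hu, hv, PiLp.inner_apply, Fin.sum_univ_three]; ring
  have huw : inner ℝ u w = 0 := by simp [hu, hw, PiLp.inner_apply, Fin.sum_univ_three]
  have hvw : inner ℝ v w = 0 := by simp [hv, hw, PiLp.inner_apply, Fin.sum_univ_three]
  have hiso := isometry_frameMap nu nv nw huv huw hvw
  have key : Real.sin (θ + φ) * Real.cos θ - Real.cos (θ + φ) * Real.sin θ = Real.sin φ := by
    rw [← Real.sin_sub]; congr 1; ring
  have key' : Real.cos (θ + φ) * Real.cos θ + Real.sin (θ + φ) * Real.sin θ = Real.cos φ := by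
    rw [← Real.cos_sub]; congr 1; ring
  have hunion : sector (θ + φ) = sector θ ∪ frameMap u v w '' sector φ := by
    ext x
    constructor
    · rintro ⟨h1, h2, h3, h4⟩
      rcases le_total 0 (x 0 * Real.sin θ - x 1 * Real.cos θ) with h5 | h5
      · exact Or.inl ⟨h1, h2, h3, h5⟩
      · refine Or.inr ⟨!₂[x 0 * Real.cos θ + x 1 * Real.sin θ,
          x 1 * Real.cos θ - x 0 * Real.sin θ, x 2], ?_, ?_⟩
        · refine ⟨norm_eq_one_of_sq_three ?_, ?_, ?_, ?_⟩
          · simp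
            linear_combination sq_add_sq_add_sq h1 + (x 0 ^ 2 + x 1 ^ 2) * hcs
          · simpa using h2
          · simp; linarith
          · simp
            rw [← key, ← key']
            linear_combination h4 +
              (x 1 * Real.cos (θ + φ) - x 0 * Real.sin (θ + φ)) * hcs
        · ext i
          fin_cases i <;> simp [frameMap, hu, hv, hw]
          · linear_combination x 0 * hcs
          · linear_combination x 1 * hcs
    · rintro (⟨h1, h2, h3, h4⟩ | ⟨x, ⟨h1, h2, h3, h4⟩, rfl⟩)
      · refine ⟨h1, h2, h3, ?_⟩
        refine nonneg_of_mul_nonneg_right (a := Real.sin θ) ?_ hsθ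
        have : Real.sin θ * (x 0 * Real.sin (θ + φ) - x 1 * Real.cos (θ + φ)) =
            Real.sin (θ + φ) * (x 0 * Real.sin θ - x 1 * Real.cos θ) + Real.sin φ * x 1 := by
          linear_combination x 1 * key
        rw [this]
        positivity
      · refine ⟨by rw [norm_frameMap nu nv nw huv huw hvw, h1], ?_, ?_, ?_⟩
        · simpa [frameMap, hu, hv, hw] using h2
        · simp [frameMap, hu, hv, hw]
          refine nonneg_of_mul_nonneg_right (a := Real.sin φ) ?_ hsφ
          have : Real.sin φ * (x 0 * Real.sin θ + x 1 * Real.cos θ) =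
            Real.sin θ * (x 0 * Real.sin φ - x 1 * Real.cos φ) + Real.sin (θ + φ) * x 1 := by
            rw [Real.sin_add]; ring
          rw [this]
          positivity
        · simp [frameMap, hu, hv, hw]
          rw [← key, ← key'] at h4
          linear_combination h4
  have hdisj : AEDisjoint μH[2] (sector θ) (frameMap u v w '' sector φ) := by
    have hn : (!₂[Real.sin θ, -Real.cos θ, 0] : EuclideanSpace ℝ (Fin 3)) ≠ 0 := fun h0 => by
      simpa [hsθ.ne'] using congr($h0 0)
    refine measure_mono_null ?_ (hausdorffMeasure_greatCircle hn)
    rintro _ ⟨⟨h1, -, -, h4⟩, ⟨x, ⟨-, -, h3, -⟩, rfl⟩⟩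
    refine ⟨h1, ?_⟩
    have e : frameMap u v w x 0 * Real.sin θ - frameMap u v w x 1 * Real.cos θ = - x 1 := by
      simp [frameMap, hu, hv, hw]
      linear_combination -x 1 * hcs
    have : inner ℝ (!₂[Real.sin θ, -Real.cos θ, 0] : EuclideanSpace ℝ (Fin 3))
        (frameMap u v w x) =
        frameMap u v w x 0 * Real.sin θ - frameMap u v w x 1 * Real.cos θ := by
      simp [PiLp.inner_apply, Fin.sum_univ_three]; ring
    rw [this]
    linarith
  rw [sectorArea, hunion, measure_union₀' (isClosed_sector θ).nullMeasurableSet hdisj,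
    hiso.hausdorffMeasure_image (Or.inl zero_le_two),
    ENNReal.toReal_add (hausdorffMeasure_sector_ne_top _) (hausdorffMeasure_sector_ne_top _)]
  rfl

lemma sectorArea_injOn : InjOn sectorArea (Ioc 0 Real.pi) := by
  have key {θ φ : ℝ} (hθ : 0 < θ) (hφ : φ ≤ Real.pi) (h : θ < φ) :
      sectorArea θ < sectorArea φ := by
    have := sectorArea_add hθ (sub_pos.2 h) (by linarith)
    rw [add_sub_cancel] at this
    linarith [sectorArea_pos (sub_pos.2 h) (by linarith)]
  intro θ hθ φ hφ he
  rcases lt_trichotomy θ φ with h | h | h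
  · exact absurd he (key hθ.1 hφ.2 h).ne
  · exact h
  · exact absurd he (key hφ.1 hθ.2 h).ne'

lemma sectorArea_pi_sub {θ : ℝ} (hθ : 0 < θ) (h : θ < Real.pi) :
    sectorArea (Real.pi - θ) = sectorArea Real.pi - sectorArea θ := by
  have := sectorArea_add hθ (sub_pos.2 h) (by linarith)
  rw [add_sub_cancel] at this
  linarith

lemma sectorArea_sub {θ φ : ℝ} (hθ : 0 < θ) (h : θ < φ) (hφ : φ ≤ Real.pi) :
    sectorArea (φ - θ) = sectorArea φ - sectorArea θ := by
  have := sectorArea_add hθ (sub_pos.2 h) (by linarith)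
  rw [add_sub_cancel] at this
  linarith

end

/-! ### Surface area -/

noncomputable section

open Set MeasureTheory
open scoped ENNReal

lemma hausdorffMeasure_coe_image (S : Set S3) : μH[2] (((↑) : S3 → E4) '' S) = μH[2] S :=
  isometry_subtype_coe.hausdorffMeasure_image (Or.inl zero_le_two) S

lemma hausdorffMeasure_cell_eq_zero {n : ℕ} (p : Fin n → S3) {s : Finset (Fin n)}
    (hs : s.card ≤ 2) : μH[2] (cell p s) = 0 := by
  rw [← hausdorffMeasure_coe_image]
  refine measure_mono_null ?_ (hausdorffMeasure_unit_inter_submodule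
    (Submodule.span ℝ (s.image fun i => (p i : E4) : Finset E4)) ?_)
  · rintro _ ⟨z, ⟨c, hc, e⟩, rfl⟩
    refine ⟨by simp, ?_⟩
    rw [e]
    exact Submodule.sum_mem _ fun i hi =>
      Submodule.smul_mem _ _ (Submodule.subset_span (Finset.mem_coe.2 (Finset.mem_image_of_mem _ hi)))
  · exact (finrank_span_finset_le_card _).trans (Finset.card_image_le.trans hs)

/-- A spherical triangle with two right angles is congruent to a sector of a hemisphere. -/
lemma hausdorffMeasure_cell_eq_sector {n : ℕ} {p : Fin n → S3} {i j k : Fin n} (hij : i ≠ j)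
    (hik : i ≠ k) (hjk : j ≠ k) {u : E4} {θ : ℝ} (hθ : 0 < Real.sin θ) (hu : ‖u‖ = 1)
    (hiu : inner ℝ (p i : E4) u = 0) (hiw : inner ℝ (p i : E4) (p k : E4) = 0)
    (huw : inner ℝ u (p k : E4) = 0)
    (hj : (p j : E4) = Real.cos θ • (p i : E4) + Real.sin θ • u) :
    μH[2] (cell p {i, j, k}) = μH[2] (sector θ) := by
  have hi1 : ‖(p i : E4)‖ = 1 := by simp
  have hk1 : ‖(p k : E4)‖ = 1 := by simp
  have hiso := isometry_frameMap hi1 hu hk1 hiu hiw huw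
  have hnorm := norm_frameMap hi1 hu hk1 hiu hiw huw
  rw [← hausdorffMeasure_coe_image, ← hiso.hausdorffMeasure_image (Or.inl zero_le_two)]
  congr 1
  have hsum (c : Fin n → ℝ) : ∑ m ∈ {i, j, k}, c m • (p m : E4) =
      frameMap (p i : E4) u (p k : E4)
        !₂[c i + c j * Real.cos θ, c j * Real.sin θ, c k] := by
    rw [Finset.sum_insert (by simp [hij, hik]), Finset.sum_insert (by simp [hjk]),
      Finset.sum_singleton, hj, frameMap]
    simp
    module
  ext z
  constructor
  · rintro ⟨z, ⟨c, hc, e⟩, rfl⟩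
    rw [hsum] at e
    refine ⟨_, ⟨?_, ?_, ?_, ?_⟩, e.symm⟩
    · rw [← hnorm, ← e]; simp
    · simpa using hc k
    · simpa using mul_nonneg (hc j) hθ.le
    · simp
      nlinarith [mul_nonneg (hc i) hθ.le]
  · rintro ⟨x, ⟨h1, h2, h3, h4⟩, rfl⟩
    refine ⟨⟨frameMap (p i : E4) u (p k : E4) x, by simp [hnorm, h1]⟩, ?_, rfl⟩
    refine ⟨fun m => if m = i then (x 0 * Real.sin θ - x 1 * Real.cos θ) / Real.sin θ
      else if m = j then x 1 / Real.sin θ else x 2, fun m => ?_, ?_⟩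
    · dsimp only
      split_ifs <;> positivity
    · rw [hsum]
      refine congr_arg (frameMap (p i : E4) u (p k : E4)) ?_
      ext m
      fin_cases m <;> simp [hij.symm, hik.symm, hjk.symm] <;> field_simp
      ring

/-- The quadrilateral `0123` in the great sphere that contains it. -/
def baseQuad (x X y Y : ℝ) : Set (EuclideanSpace ℝ (Fin 3)) :=
  {v | ‖v‖ = 1 ∧ 0 ≤ v 1 ∧ Y * v 2 ≤ y * v 0 ∧ (x * v 0 ≤ X * v 1 ∨ v 2 ≤ 0)}

/-- A convex quadrilateral with three right angles. -/
def lambertQuad (x X y Y : ℝ) : Set (EuclideanSpace ℝ (Fin 3)) :=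
  {v | ‖v‖ = 1 ∧ 0 ≤ v 1 ∧ X * v 1 ≤ x * v 0 ∧ 0 ≤ v 2 ∧ Y * v 2 ≤ y * v 0}

/-- A spherical digon with right angles. -/
def rightLune (y Y : ℝ) : Set (EuclideanSpace ℝ (Fin 3)) :=
  {v | ‖v‖ = 1 ∧ 0 ≤ v 1 ∧ Y * v 2 ≤ y * v 0}

lemma baseQuad_union_lambertQuad (x X y Y : ℝ) :
    baseQuad x X y Y ∪ lambertQuad x X y Y = rightLune y Y := by
  ext v
  constructor
  · rintro (⟨h1, h2, h3, -⟩ | ⟨h1, h2, -, -, h3⟩) <;> exact ⟨h1, h2, h3⟩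
  · rintro ⟨h1, h2, h3⟩
    by_cases h : x * v 0 ≤ X * v 1 ∨ v 2 ≤ 0
    · exact Or.inl ⟨h1, h2, h3, h⟩
    · push Not at h
      exact Or.inr ⟨h1, h2, h.1.le, h.2.le, h3⟩

lemma hausdorffMeasure_baseQuad_add {x X : ℝ} (y Y : ℝ) (hX : 0 < X) :
    μH[2] (baseQuad x X y Y) + μH[2] (lambertQuad x X y Y) = μH[2] (rightLune y Y) := by
  have hm : MeasurableSet (lambertQuad x X y Y) := by
    have e (i : Fin 3) : Measurable fun v : EuclideanSpace ℝ (Fin 3) => v i := by fun_prop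
    exact (measurableSet_eq_fun measurable_norm measurable_const).inter
      ((measurableSet_le measurable_const (e 1)).inter
      ((measurableSet_le ((e 1).const_mul X) ((e 0).const_mul x)).inter
      ((measurableSet_le measurable_const (e 2)).inter
      (measurableSet_le ((e 2).const_mul Y) ((e 0).const_mul y)))))
  rw [← baseQuad_union_lambertQuad x X y Y, measure_union₀ hm.nullMeasurableSet]
  have h1 : (!₂[-x, X, 0] : EuclideanSpace ℝ (Fin 3)) ≠ 0 := fun h0 => by
    simpa [hX.ne'] using congr($h0 1)
  have h2 : (!₂[0, 0, 1] : EuclideanSpace ℝ (Fin 3)) ≠ 0 := fun h0 => by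
    simpa using congr($h0 2)
  refine measure_mono_null ?_ (measure_union_null (hausdorffMeasure_greatCircle h1)
    (hausdorffMeasure_greatCircle h2))
  rintro v ⟨⟨hv, -, -, h | h⟩, ⟨-, -, h', h'', -⟩⟩
  · left
    refine ⟨hv, ?_⟩
    simp [PiLp.inner_apply, Fin.sum_univ_three]
    linarith
  · right
    refine ⟨hv, ?_⟩
    simp [PiLp.inner_apply, Fin.sum_univ_three]
    linarith

/-- The isometry interchanges the last two coordinates. -/
lemma hausdorffMeasure_lambertQuad_swap (x X y Y : ℝ) :
    μH[2] (lambertQuad y Y x X) = μH[2] (lambertQuad x X y Y) := by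
  set u : EuclideanSpace ℝ (Fin 3) := !₂[1, 0, 0] with hu
  set v : EuclideanSpace ℝ (Fin 3) := !₂[0, 0, 1] with hv
  set w : EuclideanSpace ℝ (Fin 3) := !₂[0, 1, 0] with hw
  have nu : ‖u‖ = 1 := norm_eq_one_of_sq_three (by simp [hu])
  have nv : ‖v‖ = 1 := norm_eq_one_of_sq_three (by simp [hv])
  have nw : ‖w‖ = 1 := norm_eq_one_of_sq_three (by simp [hw])
  have huv : inner ℝ u v = 0 := by simp [hu, hv, PiLp.inner_apply, Fin.sum_univ_three]
  have huw : inner ℝ u w = 0 := by simp [hu, hw, PiLp.inner_apply, Fin.sum_univ_three]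
  have hvw : inner ℝ v w = 0 := by simp [hv, hw, PiLp.inner_apply, Fin.sum_univ_three]
  rw [← (isometry_frameMap nu nv nw huv huw hvw).hausdorffMeasure_image (Or.inl zero_le_two)
    (lambertQuad x X y Y)]
  congr 1
  ext a
  constructor
  · rintro ⟨h1, h2, h3, h4, h5⟩
    refine ⟨!₂[a 0, a 2, a 1], ⟨norm_eq_one_of_sq_three ?_, ?_, ?_, ?_, ?_⟩, ?_⟩
    · simpa [add_right_comm] using sq_add_sq_add_sq h1
    · simpa using h4
    · simpa using h5
    · simpa using h2
    · simpa using h3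
    · ext i
      fin_cases i <;> simp [frameMap, hu, hv, hw]
  · rintro ⟨a, ⟨h1, h2, h3, h4, h5⟩, rfl⟩
    refine ⟨by rw [norm_frameMap nu nv nw huv huw hvw, h1], ?_, ?_, ?_, ?_⟩ <;>
    simpa [frameMap, hu, hv, hw]

/-- Rotating the plane of the first and third coordinates carries one right-angled lune to any
other. -/
lemma hausdorffMeasure_rightLune {y Y : ℝ} (hy : y ^ 2 + Y ^ 2 = 1) :
    μH[2] (rightLune y Y) = μH[2] (rightLune 0 1) := by
  set u : EuclideanSpace ℝ (Fin 3) := !₂[Y, 0, y] with hu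
  set v : EuclideanSpace ℝ (Fin 3) := !₂[0, 1, 0] with hv
  set w : EuclideanSpace ℝ (Fin 3) := !₂[-y, 0, Y] with hw
  have nu : ‖u‖ = 1 := norm_eq_one_of_sq_three (by simp [hu]; linarith)
  have nv : ‖v‖ = 1 := norm_eq_one_of_sq_three (by simp [hv])
  have nw : ‖w‖ = 1 := norm_eq_one_of_sq_three (by simp [hw]; linarith)
  have huv : inner ℝ u v = 0 := by simp [hu, hv, PiLp.inner_apply, Fin.sum_univ_three]
  have huw : inner ℝ u w = 0 := by
    simp [hu, hw, PiLp.inner_apply, Fin.sum_univ_three]; ring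
  have hvw : inner ℝ v w = 0 := by simp [hv, hw, PiLp.inner_apply, Fin.sum_univ_three]
  rw [← (isometry_frameMap nu nv nw huv huw hvw).hausdorffMeasure_image (Or.inl zero_le_two)
    (rightLune 0 1)]
  congr 1
  ext a
  constructor
  · rintro ⟨h1, h2, h3⟩
    refine ⟨!₂[Y * a 0 + y * a 2, a 1, Y * a 2 - y * a 0],
      ⟨norm_eq_one_of_sq_three ?_, ?_, ?_⟩, ?_⟩
    · simp
      linear_combination sq_add_sq_add_sq h1 + (a 0 ^ 2 + a 2 ^ 2) * hy
    · simpa using h2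
    · simpa using h3
    · ext i
      fin_cases i <;> simp [frameMap, hu, hv, hw]
      · linear_combination a 0 * hy
      · linear_combination a 2 * hy
  · rintro ⟨a, ⟨h1, h2, h3⟩, rfl⟩
    refine ⟨by rw [norm_frameMap nu nv nw huv huw hvw, h1], ?_, ?_⟩
    · simpa [frameMap, hu, hv, hw]
    · simp at h3
      simp [frameMap, hu, hv, hw]
      linear_combination h3 + a 2 * hy

lemma hausdorffMeasure_ne_top_of_unit {s : Set (EuclideanSpace ℝ (Fin 3))}
    (hs : ∀ v ∈ s, ‖v‖ = 1) : μH[2] s ≠ ∞ :=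
  ((measure_mono hs).trans_lt hausdorffMeasure_unitSphere_lt_top).ne

/-- Both bases complement congruent Lambert quadrilaterals in congruent lunes; finiteness allows the
cancellation. -/
lemma hausdorffMeasure_baseQuad_swap {x X y Y : ℝ} (hX : 0 < X) (hY : 0 < Y)
    (hx : x ^ 2 + X ^ 2 = 1) (hy : y ^ 2 + Y ^ 2 = 1) :
    μH[2] (baseQuad y Y x X) = μH[2] (baseQuad x X y Y) := by
  have h1 := hausdorffMeasure_baseQuad_add (x := x) y Y hX
  have h2 := hausdorffMeasure_baseQuad_add (x := y) x X hY
  rw [hausdorffMeasure_rightLune hy] at h1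
  rw [hausdorffMeasure_rightLune hx, hausdorffMeasure_lambertQuad_swap, ← h1] at h2
  exact (ENNReal.add_left_inj (hausdorffMeasure_ne_top_of_unit fun _ h => h.1)).1 h2

lemma pyramid_faces_image : pyramid.faces.image vertexSet =
    {{0, 1, 4}, {1, 2, 4}, {3, 2, 4}, {0, 3, 4}, {0, 1, 3}, {1, 2, 3}} := by
  decide +kernel

lemma card_inter_le_of_mem_pyramid_faces : ∀ s ∈ pyramid.faces.image vertexSet,
    ∀ s' ∈ pyramid.faces.image vertexSet, s ≠ s' → (s ∩ s').card ≤ 2 := by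
  decide +kernel

lemma avoid_of_mem_pyramid_faces : ∀ s ∈ pyramid.faces.image vertexSet,
    (0 : Fin 5) ∉ s ∨ 2 ∉ s := by
  decide +kernel

namespace Admissible

variable {x X y Y ρ : ℝ} (h : Admissible x X y Y ρ)
include h

lemma hausdorffMeasure_base :
    μH[2] (cell (vertexPos x X y Y ρ) {0, 1, 3} ∪ cell (vertexPos x X y Y ρ) {1, 2, 3}) =
      μH[2] (baseQuad x X y Y) := by
  have hx := h.x_pos
  have hX := h.X_pos
  have hy := h.y_pos
  have hY := h.Y_pos
  have hρ := h.ρ_pos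
  set u : E4 := !₂[1, 0, 0, 0] with hu
  set v : E4 := !₂[0, 1, 0, 0] with hv
  set w : E4 := !₂[0, 0, 1, 0] with hw
  have nu : ‖u‖ = 1 := norm_eq_one_of_sq (by simp [hu])
  have nv : ‖v‖ = 1 := norm_eq_one_of_sq (by simp [hv])
  have nw : ‖w‖ = 1 := norm_eq_one_of_sq (by simp [hw])
  have huv : inner ℝ u v = 0 := by simp [hu, hv, PiLp.inner_apply, Fin.sum_univ_four]
  have huw : inner ℝ u w = 0 := by simp [hu, hw, PiLp.inner_apply, Fin.sum_univ_four]
  have hvw : inner ℝ v w = 0 := by simp [hv, hw, PiLp.inner_apply, Fin.sum_univ_four]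
  have hnorm := norm_frameMap nu nv nw huv huw hvw
  have hframe (a : EuclideanSpace ℝ (Fin 3)) : frameMap u v w a = !₂[a 0, a 1, a 2, 0] := by
    ext i
    fin_cases i <;> simp [frameMap, hu, hv, hw]
  rw [← hausdorffMeasure_coe_image,
    ← (isometry_frameMap nu nv nw huv huw hvw).hausdorffMeasure_image (Or.inl zero_le_two)]
  congr 1
  ext z
  constructor
  · rintro ⟨z, hz, rfl⟩
    obtain ⟨c, hc, e, h4, hs⟩ : ∃ c : Fin 5 → ℝ, (∀ i, 0 ≤ c i) ∧
        (z : E4) = ∑ i, c i • (vertexPos x X y Y ρ i : E4) ∧ c 4 = 0 ∧ (c 2 = 0 ∨ c 0 = 0) := by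
      rcases hz with hz | hz <;> obtain ⟨c, hc, hs, e⟩ := mem_cell_iff.1 hz
      · exact ⟨c, hc, e, hs 4 (by decide), Or.inl (hs 2 (by decide))⟩
      · exact ⟨c, hc, e, hs 4 (by decide), Or.inr (hs 0 (by decide))⟩
    rw [h.sum_vertexPos, h4] at e
    have e' : (z : E4) = frameMap u v w !₂[c 0 + c 1 * X + c 2 * (X * Y / ρ) - c 3 * Y,
        c 1 * x + c 2 * (x * Y / ρ), c 2 * (X * y / ρ) - c 3 * y] := by
      rw [e, hframe]
      simp
    have hc0 := hc 0
    have hc1 := hc 1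
    have hc2 := hc 2
    have hc3 := hc 3
    refine ⟨_, ⟨?_, ?_, ?_, ?_⟩, e'.symm⟩
    · rw [← hnorm, ← e']; simp
    · simp; positivity
    · simp
      have : 0 ≤ y * (c 0 + c 1 * X) := by positivity
      linear_combination this
    · rcases hs with hs | hs
      · right
        simp [hs]; positivity
      · left
        simp [hs]
        have : 0 ≤ x * (c 3 * Y) := by positivity
        linear_combination this
  · rintro ⟨a, ⟨h1, h2, h3, h4⟩, rfl⟩
    -- This linear form vanishes at the vertices `1` and `3`, is positive at `0` and negative at
    -- `2`. Its sign decides on which side of the diagonal the point lies.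
    obtain ⟨α, hα⟩ : ∃ α, α = a 0 - X * a 1 / x - Y * a 2 / y := ⟨_, rfl⟩
    refine ⟨⟨frameMap u v w a, by simp [hnorm, h1]⟩, ?_, rfl⟩
    rcases le_total 0 α with h0 | h0
    · left
      have h5 : a 2 ≤ 0 := by
        rcases h4 with h4 | h4
        · have : x * α = x * a 0 - X * a 1 - x * Y / y * a 2 := by
            rw [hα]; field_simp
          have h6 : 0 ≤ x * α := by positivity
          have h7 : x * Y / y * a 2 ≤ 0 := by linarith
          exact nonpos_of_mul_nonpos_right h7 (by positivity)
        · exact h4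
      refine mem_cell_iff.2 ⟨![α, a 1 / x, 0, -a 2 / y, 0], fun i => ?_, fun i hi => ?_, ?_⟩
      · have : 0 ≤ -a 2 / y := div_nonneg (by linarith) hy.le
        fin_cases i <;> simp <;> first | assumption | positivity
      · fin_cases i <;> simp at hi ⊢
      · rw [h.sum_vertexPos]
        refine (hframe a).trans ?_
        ext i
        fin_cases i <;> simp [hα] <;> field_simp
        ring
    · right
      have h5 : x * a 0 ≤ X * a 1 := by
        rcases h4 with h4 | h4
        · exact h4
        · have : x * α = x * a 0 - X * a 1 - x * Y / y * a 2 := by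
            rw [hα]; field_simp
          have h6 : x * α ≤ 0 := mul_nonpos_of_nonneg_of_nonpos hx.le h0
          have h7 : x * Y / y * a 2 ≤ 0 := mul_nonpos_of_nonneg_of_nonpos (by positivity) h4
          linarith
      refine mem_cell_iff.2 ⟨![0, (y * a 0 - Y * a 2) / (X * y), -α * ρ / (X * Y),
        (X * a 1 - x * a 0) / (x * Y), 0], fun i => ?_, fun i hi => ?_, ?_⟩
      · have e1 : 0 ≤ (y * a 0 - Y * a 2) / (X * y) := div_nonneg (by linarith) (by positivity)
        have e2 : 0 ≤ -α * ρ / (X * Y) :=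
          div_nonneg (mul_nonneg (by linarith) hρ.le) (by positivity)
        have e3 : 0 ≤ (X * a 1 - x * a 0) / (x * Y) := div_nonneg (by linarith) (by positivity)
        fin_cases i
        exacts [le_rfl, e1, e2, e3, le_rfl]
      · fin_cases i <;> simp at hi ⊢
      · rw [h.sum_vertexPos]
        refine (hframe a).trans ?_
        ext i
        fin_cases i <;> simp [hα] <;> field_simp <;> ring

lemma Y_lt_ρ : Y < ρ := by
  have h1 : ρ ^ 2 - Y ^ 2 = X ^ 2 * y ^ 2 := by
    linear_combination h.ρ_sq - h.y_sq - y ^ 2 * h.x_sq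
  have h2 : 0 < X ^ 2 * y ^ 2 := by have := h.y_pos; have := h.X_pos; positivity
  exact lt_of_pow_lt_pow_left₀ 2 h.ρ_pos.le (by linarith)

lemma hausdorffMeasure_side {i j : Fin 5} (hij : i ≠ j) (hi : i ≠ 4) (hj : j ≠ 4) {u : E4}
    {c s : ℝ} (hs : 0 < s) (hcs : c ^ 2 + s ^ 2 = 1) (hu : ‖u‖ = 1)
    (hiu : inner ℝ (vertexVec x X y Y ρ i) u = 0) (hu4 : inner ℝ u (vertexVec x X y Y ρ 4) = 0)
    (e : vertexVec x X y Y ρ j = c • vertexVec x X y Y ρ i + s • u) :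
    μH[2] (cell (vertexPos x X y Y ρ) {i, j, 4}) = μH[2] (sector (Real.arccos c)) := by
  have hsin : Real.sin (Real.arccos c) = s := by
    rw [Real.sin_arccos, show 1 - c ^ 2 = s ^ 2 by linarith, Real.sqrt_sq hs.le]
  have hcos : Real.cos (Real.arccos c) = c := Real.cos_arccos (by nlinarith) (by nlinarith)
  refine hausdorffMeasure_cell_eq_sector hij hi hj (u := u) (hsin ▸ hs) hu ?_ ?_ ?_ ?_
  · rwa [h.coe_vertexPos]
  · rw [real_inner_comm, h.inner_apex hi]
  · rwa [h.coe_vertexPos]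
  · rw [hsin, hcos, h.coe_vertexPos, h.coe_vertexPos, e]

/-- Distinct triangles overlap in cells with at most two vertices, which are null. Lateral triangles
have two right angles, so they are sectors whose angles are the base sides. -/
lemma hausdorffMeasure_surface : μH[2] (pyramid.surface (vertexPos x X y Y ρ)) =
    μH[2] (sector (Real.arccos X)) + (μH[2] (sector (Real.arccos (Y / ρ))) +
      (μH[2] (sector (Real.pi - Real.arccos (X / ρ))) +
        (μH[2] (sector (Real.pi - Real.arccos Y)) + μH[2] (baseQuad x X y Y)))) := by
  have hx := h.x_pos
  have hX := h.X_pos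
  have hy := h.y_pos
  have hY := h.Y_pos
  have hρ := h.ρ_pos
  have hρ2 := h.ρ_sq
  have hx2 := h.x_sq
  have hy2 := h.y_sq
  set p := vertexPos x X y Y ρ with hp
  have hmeas (s : Finset (Fin 5)) : NullMeasurableSet (cell p s) μH[2] :=
    (h.isCompact_cell s).measurableSet.nullMeasurableSet
  have hdisj : ∀ s ∈ pyramid.faces.image vertexSet, ∀ s' ∈ pyramid.faces.image vertexSet,
      s ≠ s' → AEDisjoint μH[2] (cell p s) (cell p s') := fun s hs s' hs' hne =>
    measure_mono_null (h.cell_inter_subset (avoid_of_mem_pyramid_faces s hs)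
      (avoid_of_mem_pyramid_faces s' hs'))
      (hausdorffMeasure_cell_eq_zero p (card_inter_le_of_mem_pyramid_faces s hs s' hs' hne))
  have hsurf : pyramid.surface p = ⋃ s ∈ pyramid.faces.image vertexSet, cell p s := by
    rw [Finset.set_biUnion_finset_image]
    rfl
  have hbase : μH[2] (cell p {0, 1, 3}) + μH[2] (cell p {1, 2, 3}) =
      μH[2] (baseQuad x X y Y) := by
    rw [← h.hausdorffMeasure_base, measure_union₀ (hmeas _)]
    refine hdisj _ ?_ _ ?_ (by decide) <;> rw [pyramid_faces_image] <;> decide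
  have h01 : μH[2] (cell p {0, 1, 4}) = μH[2] (sector (Real.arccos X)) := by
    refine h.hausdorffMeasure_side (u := !₂[0, 1, 0, 0]) (s := x) (by decide) (by decide)
      (by decide) hx (by linarith) (norm_eq_one_of_sq (by simp)) ?_ ?_ ?_
    iterate 2 · simp [vertexVec, PiLp.inner_apply, Fin.sum_univ_four]
    ext i; fin_cases i <;> simp [vertexVec]
  have h12 : μH[2] (cell p {1, 2, 4}) = μH[2] (sector (Real.arccos (Y / ρ))) := by
    refine h.hausdorffMeasure_side (u := !₂[0, 0, 1, 0]) (s := X * y / ρ) (by decide) (by decide)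
      (by decide) (by positivity) ?_ (norm_eq_one_of_sq (by simp)) ?_ ?_ ?_
    · field_simp
      linear_combination y ^ 2 * hx2 - hρ2 + hy2
    iterate 2 · simp [vertexVec, PiLp.inner_apply, Fin.sum_univ_four]
    ext i; fin_cases i <;> simp [vertexVec] <;> ring
  have h32 : μH[2] (cell p {3, 2, 4}) = μH[2] (sector (Real.pi - Real.arccos (X / ρ))) := by
    rw [← Real.arccos_neg]
    refine h.hausdorffMeasure_side (u := !₂[0, 1, 0, 0]) (s := x * Y / ρ) (by decide) (by decide)
      (by decide) (by positivity) ?_ (norm_eq_one_of_sq (by simp)) ?_ ?_ ?_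
    · field_simp
      linear_combination x ^ 2 * hy2 - hρ2 + hx2
    iterate 2 · simp [vertexVec, PiLp.inner_apply, Fin.sum_univ_four]
    ext i; fin_cases i <;> simp [vertexVec] <;> ring
  have h03 : μH[2] (cell p {0, 3, 4}) = μH[2] (sector (Real.pi - Real.arccos Y)) := by
    rw [← Real.arccos_neg]
    refine h.hausdorffMeasure_side (u := !₂[0, 0, -1, 0]) (s := y) (by decide) (by decide)
      (by decide) hy (by linarith) (norm_eq_one_of_sq (by simp)) ?_ ?_ ?_
    iterate 2 · simp [vertexVec, PiLp.inner_apply, Fin.sum_univ_four]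
    ext i; fin_cases i <;> simp [vertexVec]
  rw [hsurf, measure_biUnion_finset₀ (fun s hs s' hs' => hdisj s hs s' hs') fun s _ => hmeas s,
    pyramid_faces_image]
  rw [Finset.sum_insert (by decide), Finset.sum_insert (by decide), Finset.sum_insert (by decide),
    Finset.sum_insert (by decide), Finset.sum_insert (by decide), Finset.sum_singleton, hbase,
    h01, h12, h32, h03]

end Admissible

/-- The equal base areas cancel. Additivity turns equality of the lateral areas into equality of two
sector areas, and injectivity in the angle contradicts `arccos_sub_arccos_ne`. -/
lemma surfaceArea_ne {ρ : ℝ} (h₀ : Admissible (4 / 5) (3 / 5) (3 / 5) (4 / 5) ρ)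
    (h₁ : Admissible (3 / 5) (4 / 5) (4 / 5) (3 / 5) ρ) :
    surfaceArea (pyramid.surface (vertexPos (3 / 5) (4 / 5) (4 / 5) (3 / 5) ρ)) ≠
      surfaceArea (pyramid.surface (vertexPos (4 / 5) (3 / 5) (3 / 5) (4 / 5) ρ)) := by
  intro he
  have hπ := Real.pi_pos
  have hρ := h₀.ρ_pos
  rw [surfaceArea, surfaceArea, ENNReal.mul_right_inj (by simpa using hπ) ENNReal.ofReal_ne_top,
    h₀.hausdorffMeasure_surface, h₁.hausdorffMeasure_surface,
    hausdorffMeasure_baseQuad_swap (by norm_num) (by norm_num) (by norm_num) (by norm_num)] at he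
  have hq : μH[2] (baseQuad (4 / 5) (3 / 5) (3 / 5) (4 / 5)) ≠ ∞ :=
    hausdorffMeasure_ne_top_of_unit fun _ h => h.1
  have hs := hausdorffMeasure_sector_ne_top
  simp only [← add_assoc] at he
  rw [ENNReal.add_left_inj hq] at he
  have he' := congr_arg ENNReal.toReal he
  simp only [ENNReal.toReal_add (ENNReal.add_ne_top.2 ⟨ENNReal.add_ne_top.2 ⟨hs _, hs _⟩, hs _⟩)
    (hs _), ENNReal.toReal_add (ENNReal.add_ne_top.2 ⟨hs _, hs _⟩) (hs _),
    ENNReal.toReal_add (hs _) (hs _)] at he'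
  have hacute {c : ℝ} (h0 : 0 < c) (h1 : c < 1) :
      0 < Real.arccos c ∧ Real.arccos c < Real.pi :=
    ⟨Real.arccos_pos.2 h1, by linarith [Real.arccos_lt_pi_div_two.2 h0]⟩
  have hlt : (3 / 5 : ℝ) / ρ < 4 / 5 / ρ := by gcongr; norm_num
  have h1 : (4 / 5 : ℝ) / ρ < 1 := (div_lt_one hρ).2 h₀.Y_lt_ρ
  obtain ⟨a0, a1⟩ := hacute (c := 3 / 5) (by norm_num) (by norm_num)
  obtain ⟨b0, b1⟩ := hacute (c := 4 / 5) (by norm_num) (by norm_num)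
  obtain ⟨α0, α1⟩ := hacute (c := 3 / 5 / ρ) (by positivity) (hlt.trans h1)
  obtain ⟨β0, β1⟩ := hacute (c := 4 / 5 / ρ) (by positivity) h1
  have hab : Real.arccos (4 / 5) < Real.arccos (3 / 5) :=
    Real.arccos_lt_arccos (by norm_num) (by norm_num) (by norm_num)
  have hαβ : Real.arccos (4 / 5 / ρ) < Real.arccos (3 / 5 / ρ) :=
    Real.arccos_lt_arccos (by have : 0 < 3 / 5 / ρ := by positivity
                              linarith) hlt h1.le
  refine arccos_sub_arccos_ne hρ (by rw [h₀.ρ_sq]; norm_num) (sectorArea_injOn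
    ⟨sub_pos.2 hab, by linarith⟩ ⟨sub_pos.2 hαβ, by linarith⟩ ?_)
  have e1 := sectorArea_pi_sub a0 a1
  have e2 := sectorArea_pi_sub b0 b1
  have e3 := sectorArea_pi_sub α0 α1
  have e4 := sectorArea_pi_sub β0 β1
  rw [sectorArea_sub b0 hab a1.le, sectorArea_sub β0 hαβ α1.le]
  simp only [sectorArea] at *
  linarith

lemma Congruent3.surfaceArea_eq {S S' : Set S3} (h : Congruent3 S S') :
    surfaceArea S' = surfaceArea S := by
  obtain ⟨g, rfl⟩ := h
  rw [surfaceArea, surfaceArea, g.hausdorffMeasure_image]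

end

/-! ### The deformation and the theorem -/

noncomputable section

open Set

/-- The deformation of the pyramid. -/
def flex (t : ℝ) : Fin 5 → S3 :=
  vertexPos ((4 - t) / 5) (√(1 - ((4 - t) / 5) ^ 2)) (12 / 25 / ((4 - t) / 5))
    (√(1 - (12 / 25 / ((4 - t) / 5)) ^ 2)) (√481 / 25)

/-- The map x ↦ (12/25)/x preserves the interval [3/5, 4/5], so both sines stay strictly between 0
and 1. -/
lemma admissible_of_mem_Icc {x : ℝ} (hx : x ∈ Icc (3 / 5 : ℝ) (4 / 5)) :
    Admissible x (√(1 - x ^ 2)) (12 / 25 / x) (√(1 - (12 / 25 / x) ^ 2)) (√481 / 25) := by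
  obtain ⟨h1, h2⟩ := hx
  have hx0 : 0 < x := by linarith
  have hy0 : 0 < 12 / 25 / x := by positivity
  have hy1 : 12 / 25 / x ≤ 4 / 5 := by
    rw [div_le_iff₀ hx0]
    linarith
  have hx2 : 0 < 1 - x ^ 2 := by nlinarith
  have hy2 : 0 < 1 - (12 / 25 / x) ^ 2 := by nlinarith
  have hprod : x * (12 / 25 / x) = 12 / 25 := by field_simp
  refine ⟨hx0, Real.sqrt_pos.2 hx2, hy0, Real.sqrt_pos.2 hy2, by positivity, ?_, ?_, hprod, ?_⟩
  · rw [Real.sq_sqrt hx2.le]; ring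
  · rw [Real.sq_sqrt hy2.le]; ring
  · rw [hprod, div_pow, Real.sq_sqrt (by norm_num)]; norm_num

lemma mem_Icc_flex {t : ℝ} (ht : t ∈ Icc (0 : ℝ) 1) : (4 - t) / 5 ∈ Icc (3 / 5 : ℝ) (4 / 5) :=
  ⟨by linarith [ht.2], by linarith [ht.1]⟩

lemma flex_zero : flex 0 = vertexPos (4 / 5) (3 / 5) (3 / 5) (4 / 5) (√481 / 25) := by
  have e1 : √(1 - (4 / 5 : ℝ) ^ 2) = 3 / 5 := by
    rw [show (1 - (4 / 5 : ℝ) ^ 2) = (3 / 5) ^ 2 by norm_num, Real.sqrt_sq (by norm_num)]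
  have e2 : √(1 - (3 / 5 : ℝ) ^ 2) = 4 / 5 := by
    rw [show (1 - (3 / 5 : ℝ) ^ 2) = (4 / 5) ^ 2 by norm_num, Real.sqrt_sq (by norm_num)]
  rw [flex, sub_zero, show (12 / 25 / (4 / 5) : ℝ) = 3 / 5 by norm_num, e1, e2]

lemma flex_one : flex 1 = vertexPos (3 / 5) (4 / 5) (4 / 5) (3 / 5) (√481 / 25) := by
  have e1 : √(1 - (4 / 5 : ℝ) ^ 2) = 3 / 5 := by
    rw [show (1 - (4 / 5 : ℝ) ^ 2) = (3 / 5) ^ 2 by norm_num, Real.sqrt_sq (by norm_num)]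
  have e2 : √(1 - (3 / 5 : ℝ) ^ 2) = 4 / 5 := by
    rw [show (1 - (3 / 5 : ℝ) ^ 2) = (4 / 5) ^ 2 by norm_num, Real.sqrt_sq (by norm_num)]
  rw [flex, show (4 - 1 : ℝ) / 5 = 3 / 5 by norm_num,
    show (12 / 25 / (3 / 5) : ℝ) = 4 / 5 by norm_num, e1, e2]

lemma admissible_start : Admissible (4 / 5) (3 / 5) (3 / 5) (4 / 5) (√481 / 25) := by
  refine ⟨?_, ?_, ?_, ?_, by positivity, ?_, ?_, ?_, ?_⟩ <;>
    norm_num [div_pow, Real.sq_sqrt]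

lemma admissible_end : Admissible (3 / 5) (4 / 5) (4 / 5) (3 / 5) (√481 / 25) := by
  refine ⟨?_, ?_, ?_, ?_, by positivity, ?_, ?_, ?_, ?_⟩ <;>
    norm_num [div_pow, Real.sq_sqrt]

lemma continuousOn_flex : ContinuousOn flex (Icc 0 1) := by
  rw [continuousOn_pi]
  intro i
  rw [Topology.IsInducing.subtypeVal.continuousOn_iff]
  have hx : ∀ t ∈ Icc (0 : ℝ) 1, (4 - t) / 5 ≠ 0 := fun t ht => by
    have := (mem_Icc_flex ht).1
    linarith
  refine ContinuousOn.congr (f := fun t : ℝ => vertexVec ((4 - t) / 5)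
    (√(1 - ((4 - t) / 5) ^ 2)) (12 / 25 / ((4 - t) / 5))
    (√(1 - (12 / 25 / ((4 - t) / 5)) ^ 2)) (√481 / 25) i) ?_ fun t ht =>
      (admissible_of_mem_Icc (mem_Icc_flex ht)).coe_vertexPos i
  have c1 : ContinuousOn (fun t : ℝ => (4 - t) / 5) (Icc 0 1) := by fun_prop
  have c2 : ContinuousOn (fun t : ℝ => 12 / 25 / ((4 - t) / 5)) (Icc 0 1) :=
    continuousOn_const.div c1 hx
  have c3 : ContinuousOn (fun t : ℝ => √(1 - ((4 - t) / 5) ^ 2)) (Icc 0 1) := by fun_prop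
  have c4 : ContinuousOn (fun t : ℝ => √(1 - (12 / 25 / ((4 - t) / 5)) ^ 2)) (Icc 0 1) :=
    (continuousOn_const.sub (c2.pow 2)).sqrt
  have key {a b c d : ℝ → ℝ} (ha : ContinuousOn a (Icc 0 1)) (hb : ContinuousOn b (Icc 0 1))
      (hc : ContinuousOn c (Icc 0 1)) (hd : ContinuousOn d (Icc 0 1)) :
      ContinuousOn (fun t => (!₂[a t, b t, c t, d t] : E4)) (Icc 0 1) := by
    refine (PiLp.continuous_toLp 2 _).comp_continuousOn (continuousOn_pi.2 fun j => ?_)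
    fin_cases j <;> assumption
  have c0 {r : ℝ} : ContinuousOn (fun _ : ℝ => r) (Icc 0 1) := continuousOn_const
  fin_cases i
  · exact key c0 c0 c0 c0
  · exact key c3 c1 c0 c0
  · exact key ((c3.mul c4).div_const _) ((c1.mul c4).div_const _) ((c3.mul c2).div_const _) c0
  · exact key c4.neg c0 c2.neg c0
  · exact key c0 c0 c0 c0

end

theorem theorem4 :
    ∃ (n : ℕ) (K : OrientedTriangulation n) (p : ℝ → Fin n → S3),
      -- a continuous family of polyhedra, all of them nonconvex, homeomorphic to the sphere
      -- and without selfintersections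
      ContinuousOn p (Set.Icc 0 1) ∧
      (∀ t ∈ Set.Icc (0 : ℝ) 1,
        K.Nondegenerate (p t) ∧ K.Embedded (p t) ∧ K.SphereHomeomorphic (p t) ∧
          ¬ IsConvexSurface (K.surface (p t))) ∧
      -- the dihedral angles are fixed
      (∀ h ∈ K.hinges, ∀ t ∈ Set.Icc (0 : ℝ) 1,
        OrientedTriangulation.dihedralAt (p t) h = OrientedTriangulation.dihedralAt (p 0) h) ∧
      -- the deformation is nontrivial
      (∃ t ∈ Set.Icc (0 : ℝ) 1, ¬ Congruent3 (K.surface (p 0)) (K.surface (p t))) ∧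
      -- the surface area is nonconstant
      (∃ t ∈ Set.Icc (0 : ℝ) 1, surfaceArea (K.surface (p t)) ≠ surfaceArea (K.surface (p 0))) ∧
      -- the total mean curvature is nonconstant
      (∃ t ∈ Set.Icc (0 : ℝ) 1, K.totalMeanCurvature (p t) ≠ K.totalMeanCurvature (p 0)) ∧
      -- the Gauss curvature of some vertex is nonconstant
      (∃ v : Fin n, ∃ t ∈ Set.Icc (0 : ℝ) 1,
        K.gaussCurvature (p t) v ≠ K.gaussCurvature (p 0) v) := by
  have hadm : ∀ t ∈ Set.Icc (0 : ℝ) 1, _ := fun t ht => admissible_of_mem_Icc (mem_Icc_flex ht)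
  have h1 : (1 : ℝ) ∈ Set.Icc (0 : ℝ) 1 := by simp
  have h0 : (0 : ℝ) ∈ Set.Icc (0 : ℝ) 1 := by simp
  have hπ := Real.pi_pos
  have hρ : (√481 / 25) ^ 2 = 481 / 625 := by
    rw [div_pow, Real.sq_sqrt (by norm_num)]; norm_num
  have harea : surfaceArea (pyramid.surface (flex 1)) ≠ surfaceArea (pyramid.surface (flex 0)) := by
    rw [flex_zero, flex_one]
    exact surfaceArea_ne admissible_start admissible_end
  have hper := basePerimeter_ne admissible_start.ρ_pos hρ
  refine ⟨5, pyramid, flex, continuousOn_flex, fun t ht => ⟨(hadm t ht).nondegenerate,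
    (hadm t ht).embedded, (hadm t ht).sphereHomeomorphic, (hadm t ht).not_isConvexSurface⟩,
    fun e he t ht => ((hadm t ht).dihedralAt_eq e he).trans ((hadm 0 h0).dihedralAt_eq e he).symm,
    ⟨1, h1, fun h => harea h.surfaceArea_eq⟩, ⟨1, h1, harea⟩, ⟨1, h1, ?_⟩, 4, 1, h1, ?_⟩
  · rw [flex_zero, flex_one, admissible_start.totalMeanCurvature_eq,
      admissible_end.totalMeanCurvature_eq]
    intro he
    have := mul_left_cancel₀ (by positivity) he
    exact hper (by linarith)
  · rw [flex_zero, flex_one, admissible_start.gaussCurvature_apex,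
      admissible_end.gaussCurvature_apex]
    intro he
    exact hper (by linarith)
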